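/- Let $p$ be a prime. Write $\mathcal F$ for the category of finite sets, $\mathrm{sSet}$ for the category of simplicial sets and $s\mathcal F$ for the category of simplicial finite sets (degreewise finite simplicial sets). For a category $\mathcal C$, let $\mathrm{pro}\text{-}\mathcal C$ be the category whose objects are the small cofiltered diagrams in $\mathcal C$, with $\mathrm{Hom}(X,Y)=\lim_s\operatorname{colim}_t\mathrm{Hom}_{\mathcal C}(X_t,Y_s)$, and let $s\,\mathrm{pro}\text{-}\mathcal F$ be the category of simplicial objects in $\mathrm{pro}\text{-}\mathcal F$. Consider the following functors. * $i:\mathrm{pro}\text{-}s\mathcal F\to\mathrm{pro}\text{-}\mathrm{sSet}$ is the inclusion. $\mathrm{Fin}:\mathrm{pro}\text{-}\mathrm{sSet}\to\mathrm{pro}\text{-}s\mathcal F$ is its left adjoint; $\mathrm{Fin}\,X$ is the system of all simplicial finite quotients of the simplicial sets $X_s$ (the cofiltered limit over $s$, in $\mathrm{pro}\text{-}s\mathcal F$, of the systems of simplicial finite quotients of $X_s$). * $F:\mathrm{pro}\text{-}s\mathcal F\to s\,\mathrm{pro}\text{-}\mathcal F$ is given by $(FX)_n=\{(X_s)_n\}_s$,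 and $G:s\,\mathrm{pro}\text{-}\mathcal F\to\mathrm{pro}\text{-}s\mathcal F$ is the left adjoint of $F$. Let $\mathrm{Ho}(\mathrm{pro}\text{-}\mathrm{sSet})$ be the localization of $\mathrm{pro}\text{-}\mathrm{sSet}$ at the $\mathbb Z/p$-cohomology weak equivalences, i.e. the maps $X\to Y$ inducing isomorphisms $H^n(Y;\mathbb Z/p)\to H^n(X;\mathbb Z/p)$ for all $n\ge 0$, where $H^n(X;\mathbb Z/p)=\operatorname{colim}_s H^n(X_s;\mathbb Z/p)$. Let $\mathrm{Ho}(s\,\mathrm{pro}\text{-}\mathcal F)$ be the localization of $s\,\mathrm{pro}\text{-}\mathcal F$ at the maps inducing isomorphisms on continuous cohomology with coefficients in $\mathbb Z/p$, i.e. on the cohomology of the cochain complexes $n\mapsto\operatorname{colim}_t\mathrm{Map}((Y_n)_t,\mathbb Z/p)$. (These are the homotopy categories of the $\mathbb Z/p$-cohomological model structure on pro-simplicial sets and of Morel's model structure on simplicial pro-finite sets.) **Theorem.** The functors $F\circ\mathrm{Fin}$ and $i\circ G$ preserve these weak equivalences, and the functors they induce between $\mathrm{Ho}(\mathrm{pro}\text{-}\mathrm{sSet})$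 and $\mathrm{Ho}(s\,\mathrm{pro}\text{-}\mathcal F)$ are inverse equivalences of categories. -/

import Mathlib

open CategoryTheory Opposite Limits

universe v u u₁ u₂ u₃ w

/-- A pro-object of `C`: a diagram in `C` indexed by a small cofiltered category. -/
structure Pro (C : Type u) [Category.{v} C] : Type (max u (v + 1)) where
  Index : Type v
  [smallCategory : SmallCategory Index]
  [isCofiltered : IsCofiltered Index]
  diag : Index ⥤ C

namespace Pro

attribute [instance] smallCategory isCofiltered

variable {C : Type u₁} [Category.{v} C] {D : Type u₂} [Category.{v} D]

/-- The functor `A ↦ colim_t Hom_C (X_t, A)`. -/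
noncomputable def maps (X : Pro C) : C ⥤ Type v where
  obj A := colimit (X.diag.op ⋙ yoneda.obj A)
  map g := colimMap (Functor.whiskerLeft X.diag.op (yoneda.map g))

/-- The class in `colim_t Hom_C (X_t, A)` of a morphism `X_t ⟶ A`. -/
noncomputable def germ (X : Pro C) {t : X.Index} {A : C} (f : X.diag.obj t ⟶ A) : X.maps.obj A :=
  colimit.ι (X.diag.op ⋙ yoneda.obj A) (op t) f

lemma germ_surj (X : Pro C) {A : C} (x : X.maps.obj A) :
    ∃ (t : X.Index) (f : X.diag.obj t ⟶ A), X.germ f = x := by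
  obtain ⟨t, f, h⟩ := Types.jointly_surjective' (F := X.diag.op ⋙ yoneda.obj A) x
  exact ⟨t.unop, f, h⟩

lemma germ_map (X : Pro C) {s t : X.Index} (a : s ⟶ t) {A : C} (f : X.diag.obj t ⟶ A) :
    X.germ (X.diag.map a ≫ f) = X.germ f :=
  ConcreteCategory.congr_hom (colimit.w (X.diag.op ⋙ yoneda.obj A) a.op) f

lemma maps_map_germ (X : Pro C) {t : X.Index} {A B : C} (f : X.diag.obj t ⟶ A) (g : A ⟶ B) :
    X.maps.map g (X.germ f) = X.germ (f ≫ g) :=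
  ConcreteCategory.congr_hom (ι_colimMap (Functor.whiskerLeft X.diag.op (yoneda.map g)) (op t)) f

lemma germ_eq_iff (X : Pro C) {s t : X.Index} {A : C} (f : X.diag.obj s ⟶ A)
    (g : X.diag.obj t ⟶ A) : X.germ f = X.germ g ↔
      ∃ (r : X.Index) (a : r ⟶ s) (b : r ⟶ t), X.diag.map a ≫ f = X.diag.map b ≫ g := by
  constructor
  · intro h
    obtain ⟨r, a, b, h⟩ := (Types.FilteredColimit.colimit_eq_iff
      (F := X.diag.op ⋙ yoneda.obj A) (xi := f) (xj := g)).1 h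
    exact ⟨r.unop, a.unop, b.unop, h⟩
  · rintro ⟨r, a, b, h⟩
    rw [← X.germ_map a, h, X.germ_map]

/-- The map out of `colim_t Hom_C (X_t, A)` given by a compatible family of maps out of the
sets `Hom_C (X_t, A)`. -/
noncomputable def desc (X : Pro C) {A : C} {T : Type w} (k : ∀ t, (X.diag.obj t ⟶ A) → T)
    (_hk : ∀ {s t : X.Index} (a : s ⟶ t) (f : X.diag.obj t ⟶ A),
      k s (X.diag.map a ≫ f) = k t f) (x : X.maps.obj A) : T :=
  k _ (X.germ_surj x).choose_spec.choose

lemma desc_germ (X : Pro C) {A : C} {T : Type w} (k : ∀ t, (X.diag.obj t ⟶ A) → T)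
    (hk : ∀ {s t : X.Index} (a : s ⟶ t) (f : X.diag.obj t ⟶ A),
      k s (X.diag.map a ≫ f) = k t f) {t : X.Index} (f : X.diag.obj t ⟶ A) :
    X.desc k hk (X.germ f) = k t f := by
  obtain ⟨r, a, b, h⟩ := (X.germ_eq_iff _ _).1
    (X.germ_surj (X.germ f)).choose_spec.choose_spec
  rw [desc, ← hk a, h, hk]

/-- A morphism `X ⟶ Y` of pro-objects: an element of `lim_s colim_t Hom_C (X_t, Y_s)`. -/
@[ext]
structure Hom (X Y : Pro C) where
  val (s : Y.Index) : X.maps.obj (Y.diag.obj s)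
  compat {s s' : Y.Index} (a : s ⟶ s') : X.maps.map (Y.diag.map a) (val s) = val s'

/-- The maps `colim_s Hom_C (Y_s, A) → colim_t Hom_C (X_t, A)` given by precomposition with a
morphism of pro-objects `X ⟶ Y`. -/
noncomputable def Hom.precomp {X Y : Pro C} (φ : Hom X Y) : Y.maps ⟶ X.maps where
  app A := ↾Y.desc (fun s f => X.maps.map f (φ.val s)) (fun a f => by
    rw [Functor.map_comp_apply, φ.compat])
  naturality A B g := by
    ext x
    obtain ⟨s, f, rfl⟩ := Y.germ_surj x
    simp [maps_map_germ, desc_germ]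

lemma Hom.precomp_germ {X Y : Pro C} (φ : Hom X Y) {s : Y.Index} {A : C}
    (f : Y.diag.obj s ⟶ A) :
    φ.precomp.app A (Y.germ f) = X.maps.map f (φ.val s) := by
  exact desc_germ Y (fun s f => X.maps.map f (φ.val s)) (fun a f => by
    rw [Functor.map_comp_apply, φ.compat]) f

noncomputable instance : Category.{v} (Pro C) where
  Hom := Hom
  id X := { val s := X.germ (𝟙 _)
            compat a := by
              rw [maps_map_germ, Category.id_comp, ← X.germ_map a, Category.comp_id] }
  comp {X Y Z} φ ψ :=
    { val u := φ.precomp.app _ (ψ.val u)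
      compat a := by rw [← ψ.compat a, NatTrans.naturality_apply] }
  id_comp {X Y} φ := by
    refine Hom.ext (funext fun s => ?_)
    obtain ⟨t, f, h⟩ := X.germ_surj (φ.val s)
    dsimp only
    rw [← h, Hom.precomp_germ, maps_map_germ, Category.id_comp]
  comp_id {X Y} φ := by
    refine Hom.ext (funext fun s => ?_)
    dsimp only
    rw [Hom.precomp_germ, Functor.map_id_apply]
  assoc {W X Y Z} φ ψ χ := by
    refine Hom.ext (funext fun s => ?_)
    obtain ⟨t, f, h⟩ := Y.germ_surj (χ.val s)
    dsimp only
    rw [← h, Hom.precomp_germ, Hom.precomp_germ, NatTrans.naturality_apply]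

@[ext]
lemma hom_ext {X Y : Pro C} {φ ψ : X ⟶ Y} (h : ∀ s, φ.val s = ψ.val s) : φ = ψ :=
  Hom.ext (funext h)

lemma id_val (X : Pro C) (s : X.Index) : Hom.val (𝟙 X) s = X.germ (𝟙 _) := rfl

lemma comp_val {X Y Z : Pro C} (φ : X ⟶ Y) (ψ : Y ⟶ Z) (s : Z.Index) :
    (φ ≫ ψ).val s = φ.precomp.app _ (ψ.val s) := rfl

lemma precomp_comp {X Y Z : Pro C} (φ : X ⟶ Y) (ψ : Y ⟶ Z) :
    (φ ≫ ψ).precomp = ψ.precomp ≫ φ.precomp := by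
  ext A x
  obtain ⟨s, f, rfl⟩ := Z.germ_surj x
  simp [Hom.precomp_germ, comp_val, NatTrans.naturality_apply]

/-- The constant pro-object on `A`. -/
abbrev constObj (A : C) : Pro C where
  Index := Discrete PUnit.{v + 1}
  diag := (Functor.const _).obj A

/-- The functor `c : C ⥤ pro-C`. -/
noncomputable def const : C ⥤ Pro C where
  obj A := constObj A
  map {A B} f :=
    { val _ := germ (constObj A) (t := ⟨⟨⟩⟩) f
      compat _ := by rw [maps_map_germ]; exact congrArg _ (Category.comp_id f) }
  map_id _ := rfl
  map_comp f g := by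
    ext s
    rw [comp_val]
    exact ((Hom.precomp_germ _ _).trans (maps_map_germ _ _ _)).symm

/-- The levelwise application of a functor to a pro-object. -/
abbrev mapObj (T : C ⥤ D) (X : Pro C) : Pro D where
  Index := X.Index
  diag := X.diag ⋙ T

/-- The map `colim_t Hom_C (X_t, A) → colim_t Hom_D (T X_t, T A)` induced by a functor `T`. -/
noncomputable def mapMaps (T : C ⥤ D) (X : Pro C) {A : C} :
    X.maps.obj A → (mapObj T X).maps.obj (T.obj A) :=
  X.desc (fun t f => germ (mapObj T X) (t := t) (T.map f)) (fun a f => by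
    rw [T.map_comp]; exact germ_map (mapObj T X) a _)

lemma mapMaps_germ (T : C ⥤ D) (X : Pro C) {t : X.Index} {A : C} (f : X.diag.obj t ⟶ A) :
    mapMaps T X (X.germ f) = germ (mapObj T X) (t := t) (T.map f) := by
  exact desc_germ X _ (fun a f => by rw [T.map_comp]; exact germ_map (mapObj T X) a _) f

lemma mapMaps_map (T : C ⥤ D) (X : Pro C) {A B : C} (g : A ⟶ B) (x : X.maps.obj A) :
    mapMaps T X (X.maps.map g x) = (mapObj T X).maps.map (T.map g) (mapMaps T X x) := by
  obtain ⟨t, f, rfl⟩ := X.germ_surj x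
  simp [maps_map_germ, mapMaps_germ]

/-- The levelwise application of a functor to a morphism of pro-objects. -/
noncomputable def mapHom (T : C ⥤ D) {X Y : Pro C} (φ : X ⟶ Y) : mapObj T X ⟶ mapObj T Y where
  val s := mapMaps T X (φ.val s)
  compat a := by
    rw [← φ.compat a, mapMaps_map]
    rfl

lemma mapMaps_precomp (T : C ⥤ D) {X Y : Pro C} (φ : X ⟶ Y) {A : C} (y : Y.maps.obj A) :
    mapMaps T X (φ.precomp.app A y) = (mapHom T φ).precomp.app _ (mapMaps T Y y) := by
  obtain ⟨t, f, rfl⟩ := Y.germ_surj y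
  rw [Hom.precomp_germ, mapMaps_map, mapMaps_germ]
  exact (Hom.precomp_germ (mapHom T φ) (s := t) (T.map f)).symm

/-- The functor `pro-C ⥤ pro-D` applying a functor `T : C ⥤ D` levelwise. -/
noncomputable def map (T : C ⥤ D) : Pro C ⥤ Pro D where
  obj X := mapObj T X
  map φ := mapHom T φ
  map_id X := by
    ext s
    exact (mapMaps_germ _ _ _).trans (congrArg _ (T.map_id _))
  map_comp φ ψ := by
    ext s
    exact mapMaps_precomp T φ (ψ.val s)

/-- The map `T X ⟶ T' X` of pro-objects given levelwise by a natural transformation `T ⟶ T'`. -/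
noncomputable def natHom {T T' : C ⥤ D} (α : T ⟶ T') (X : Pro C) :
    mapObj T X ⟶ mapObj T' X where
  val s := germ (mapObj T X) (t := s) (α.app (X.diag.obj s))
  compat {s s'} a := by
    refine (maps_map_germ _ _ _).trans ?_
    refine Eq.trans ?_ (germ_map (mapObj T X) (s := s) (t := s') a _)
    exact congrArg _ (α.naturality _).symm

/-- The functor `T ↦ pro-T`. -/
noncomputable def mapFunctor : (C ⥤ D) ⥤ (Pro C ⥤ Pro D) where
  obj T := map T
  map {T T'} α :=
    { app X := natHom α X
      naturality X Y φ := by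
        ext s
        obtain ⟨t, f, h⟩ := X.germ_surj (φ.val s)
        have h1 : (mapHom T φ).val s = germ (mapObj T X) (t := t) (T.map f) := by
          rw [← mapMaps_germ, h]; rfl
        have h2 : (mapHom T' φ).val s = germ (mapObj T' X) (t := t) (T'.map f) := by
          rw [← mapMaps_germ, h]; rfl
        refine (Hom.precomp_germ (mapHom T φ) (s := s) (α.app _)).trans ?_
        refine Eq.trans ?_ (congrArg ((natHom α X).precomp.app _) h2).symm
        refine Eq.trans ?_ (Hom.precomp_germ (natHom α X) (s := t) (T'.map f)).symm
        rw [h1]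
        exact ((maps_map_germ _ _ _).trans (congrArg _ (α.naturality f))).trans
          (maps_map_germ _ _ _).symm }
  map_id T := by
    ext X s
    rfl
  map_comp α β := by
    ext X s
    exact ((Hom.precomp_germ (natHom α X) (s := s) (β.app _)).trans (maps_map_germ _ _ _)).symm

section Extension

variable {E : Type u₃} [Category.{w} E] [HasColimitsOfSize.{v, v} E] (H : Cᵒᵖ ⥤ E)

/-- The morphism `H A ⟶ colim_t H (X_t)` induced by an element of `colim_t Hom_C (X_t, A)`. -/
noncomputable def pull (X : Pro C) {A : C} :
    X.maps.obj A → (H.obj (op A) ⟶ colimit (X.diag.op ⋙ H)) :=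
  X.desc (fun t f => H.map f.op ≫ colimit.ι (X.diag.op ⋙ H) (op t)) (fun a f => by
    rw [op_comp, H.map_comp, Category.assoc]
    exact congrArg _ (colimit.w (X.diag.op ⋙ H) a.op))

lemma pull_germ (X : Pro C) {t : X.Index} {A : C} (f : X.diag.obj t ⟶ A) :
    pull H X (X.germ f) = H.map f.op ≫ colimit.ι (X.diag.op ⋙ H) (op t) := by
  exact desc_germ X _ (fun a f => by
    rw [op_comp, H.map_comp, Category.assoc]
    exact congrArg _ (colimit.w (X.diag.op ⋙ H) a.op)) f

lemma pull_map (X : Pro C) {A B : C} (g : A ⟶ B) (x : X.maps.obj A) :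
    pull H X (X.maps.map g x) = H.map g.op ≫ pull H X x := by
  obtain ⟨t, f, rfl⟩ := X.germ_surj x
  simp [maps_map_germ, pull_germ]

/-- The map `colim_s H (Y_s) ⟶ colim_t H (X_t)` induced by a morphism of pro-objects. -/
noncomputable def extendMap {X Y : Pro C} (φ : X ⟶ Y) :
    colimit (Y.diag.op ⋙ H) ⟶ colimit (X.diag.op ⋙ H) :=
  colimit.desc (Y.diag.op ⋙ H)
    { pt := colimit (X.diag.op ⋙ H)
      ι := { app s := pull H X (φ.val s.unop)
             naturality s s' a := by
               rw [← φ.compat a.unop, pull_map]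
               exact (Category.comp_id _).symm } }

lemma ι_extendMap {X Y : Pro C} (φ : X ⟶ Y) (s : Y.Index) :
    colimit.ι (Y.diag.op ⋙ H) (op s) ≫ extendMap H φ = pull H X (φ.val s) :=
  colimit.ι_desc _ _

lemma pull_precomp {X Y : Pro C} (φ : X ⟶ Y) {A : C} (y : Y.maps.obj A) :
    pull H X (φ.precomp.app A y) = pull H Y y ≫ extendMap H φ := by
  obtain ⟨s, f, rfl⟩ := Y.germ_surj y
  rw [Hom.precomp_germ, pull_map, pull_germ, Category.assoc, ι_extendMap]

/-- The extension `X ↦ colim_t H (X_t)` to pro-objects of a contravariant functor `H`. -/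
noncomputable def extend : (Pro C)ᵒᵖ ⥤ E where
  obj X := colimit (X.unop.diag.op ⋙ H)
  map φ := extendMap H φ.unop
  map_id X := by
    refine colimit.hom_ext fun s => ?_
    refine (ι_extendMap H _ _).trans ?_
    rw [unop_id, id_val, pull_germ, op_id, H.map_id, Category.id_comp]
    exact (Category.comp_id _).symm
  map_comp φ ψ := by
    refine colimit.hom_ext fun s => ?_
    rw [← Category.assoc]
    refine (ι_extendMap H _ _).trans ?_
    erw [ι_extendMap]
    rw [unop_comp, comp_val, pull_precomp]

end Extension

end Pro

/-- A simplicial finite quotient of a simplicial set `K`, given by a simplicial equivalence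
relation on `K` with degreewise finite quotient. -/
structure SimplicialFiniteQuotient (K : SSet.{u}) where
  rel (n : SimplexCategoryᵒᵖ) : Setoid (K.obj n)
  map_rel {m n : SimplexCategoryᵒᵖ} (θ : m ⟶ n) {x y : K.obj m} (h : (rel m).r x y) :
    (rel n).r (K.map θ x) (K.map θ y)
  finite (n : SimplexCategoryᵒᵖ) : Finite (Quotient (rel n))

/-- The inclusion of simplicial finite sets into simplicial sets. -/
abbrev simplicialFiniteIncl : SimplicialObject FintypeCat.{u} ⥤ SSet.{u} :=
  (Functor.whiskeringRight _ _ _).obj FintypeCat.incl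

namespace SimplicialFiniteQuotient

attribute [instance] finite

variable {K : SSet.{u}}

/-- The simplicial finite set underlying a simplicial finite quotient. -/
def obj (Q : SimplicialFiniteQuotient K) : SimplicialObject FintypeCat.{u} where
  obj n := FintypeCat.of (Quotient (Q.rel n))
  map θ := FintypeCat.homMk (Quotient.map (K.map θ) fun _ _ h => Q.map_rel θ h)
  map_id n := by
    ext x
    induction x using Quotient.inductionOn with | h x =>
    exact congrArg (Quotient.mk (Q.rel n)) (Functor.map_id_apply K _ x)
  map_comp θ η := by
    ext x
    induction x using Quotient.inductionOn with | h x =>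
    exact congrArg (Quotient.mk (Q.rel _)) (Functor.map_comp_apply K θ η x)

/-- The quotient map. -/
def proj (Q : SimplicialFiniteQuotient K) : K ⟶ simplicialFiniteIncl.obj Q.obj where
  app n := ↾fun x => Quotient.mk (Q.rel n) x
  naturality _ _ _ := rfl

/-- The map from a simplicial finite quotient of `K` to a simplicial finite set `A` induced by a
map `K ⟶ A` that is compatible with the equivalence relation. -/
def lift (Q : SimplicialFiniteQuotient K) {A : SimplicialObject FintypeCat.{u}}
    (h : K ⟶ simplicialFiniteIncl.obj A)
    (hQ : ∀ n x y, (Q.rel n).r x y → h.app n x = h.app n y) : Q.obj ⟶ A where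
  app n := FintypeCat.homMk (Quotient.lift (h.app n) (hQ n))
  naturality m n θ := by
    ext x
    induction x using Quotient.inductionOn with | h x =>
    exact NatTrans.naturality_apply h θ x

lemma proj_lift (Q : SimplicialFiniteQuotient K) {A : SimplicialObject FintypeCat.{u}}
    (h : K ⟶ simplicialFiniteIncl.obj A)
    (hQ : ∀ n x y, (Q.rel n).r x y → h.app n x = h.app n y) :
    Q.proj ≫ simplicialFiniteIncl.map (Q.lift h hQ) = h := rfl

lemma hom_ext (Q : SimplicialFiniteQuotient K) {A : SimplicialObject FintypeCat.{u}}
    {g g' : Q.obj ⟶ A}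
    (h : Q.proj ≫ simplicialFiniteIncl.map g = Q.proj ≫ simplicialFiniteIncl.map g') : g = g' := by
  ext n x
  induction x using Quotient.inductionOn with | h x =>
  exact ConcreteCategory.congr_hom (congrArg (fun k => NatTrans.app k n) h) x

/-- The image of a map to a simplicial finite set, as a simplicial finite quotient. -/
def ofHom {A : SimplicialObject FintypeCat.{u}} (h : K ⟶ simplicialFiniteIncl.obj A) :
    SimplicialFiniteQuotient K where
  rel n := Setoid.ker (h.app n)
  map_rel {m n} θ x y hxy := by
    change h.app n (K.map θ x) = h.app n (K.map θ y)
    rw [NatTrans.naturality_apply, NatTrans.naturality_apply]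
    exact congrArg _ hxy
  finite n := by
    have : Finite ((simplicialFiniteIncl.obj A).obj n) := (A.obj n).property
    exact Finite.of_injective _ (Setoid.kerLift_injective (h.app n))

/-- The pullback of a simplicial finite quotient. -/
def comap {L : SSet.{u}} (u : L ⟶ K) (Q : SimplicialFiniteQuotient K) :
    SimplicialFiniteQuotient L :=
  ofHom (u ≫ Q.proj)

lemma comap_rel {L : SSet.{u}} (u : L ⟶ K) (Q : SimplicialFiniteQuotient K) {n x y}
    (h : ((Q.comap u).rel n).r x y) : (Q.rel n).r (u.app n x) (u.app n y) :=
  Quotient.exact h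

/-- The common refinement of two simplicial finite quotients. -/
def inf (Q Q' : SimplicialFiniteQuotient K) : SimplicialFiniteQuotient K where
  rel n := Q.rel n ⊓ Q'.rel n
  map_rel θ _ _ h := ⟨Q.map_rel θ h.1, Q'.map_rel θ h.2⟩
  finite n := by
    refine Finite.of_injective (β := Quotient (Q.rel n) × Quotient (Q'.rel n))
      (Quotient.lift (fun x => (Quotient.mk _ x, Quotient.mk _ x))
        fun x y h => Prod.ext (Quotient.sound h.1) (Quotient.sound h.2)) ?_
    rintro ⟨x⟩ ⟨y⟩ h
    exact Quotient.sound ⟨Quotient.exact (congrArg Prod.fst h),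
      Quotient.exact (congrArg Prod.snd h)⟩

end SimplicialFiniteQuotient

namespace Pro

/-- The index category of `Fin X`: pairs of an index `s` of `X` and a simplicial finite quotient
of `X_s`. -/
structure FinIndex (X : Pro SSet.{u}) : Type u where
  idx : X.Index
  quot : SimplicialFiniteQuotient (X.diag.obj idx)

namespace FinIndex

variable {X : Pro SSet.{u}}

/-- A morphism `(s, Q) ⟶ (s', Q')` is a morphism `s ⟶ s'` such that `X_s ⟶ X_{s'}` descends to
a (necessarily unique) map `Q ⟶ Q'`. -/
@[ext]
structure Hom (a b : FinIndex X) where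
  hom : a.idx ⟶ b.idx
  rel (n : SimplexCategoryᵒᵖ) (x y : (X.diag.obj a.idx).obj n) (h : (a.quot.rel n).r x y) :
    (b.quot.rel n).r ((X.diag.map hom).app n x) ((X.diag.map hom).app n y)

instance : SmallCategory (FinIndex X) where
  Hom := Hom
  id a := ⟨𝟙 _, fun n x y h => by simpa using h⟩
  comp f g := ⟨f.hom ≫ g.hom, fun n x y h => by simpa using g.rel n _ _ (f.rel n _ _ h)⟩
  id_comp f := Hom.ext (Category.id_comp _)
  comp_id f := Hom.ext (Category.comp_id _)
  assoc f g h := Hom.ext (Category.assoc _ _ _)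

/-- The morphism `(s, Q) ⟶ (t, Q')` over `s ⟶ t` that exists if `Q` refines the pullback of `Q'`. -/
def ofComap {s : X.Index} (b : FinIndex X) (u : s ⟶ b.idx)
    (Q : SimplicialFiniteQuotient (X.diag.obj s))
    (h : ∀ n x y, (Q.rel n).r x y → ((b.quot.comap (X.diag.map u)).rel n).r x y) :
    (⟨s, Q⟩ : FinIndex X) ⟶ b :=
  Hom.mk u fun n x y hxy => b.quot.comap_rel _ (h n x y hxy)

instance : IsCofiltered (FinIndex X) where
  nonempty := ⟨⟨Classical.choice IsCofiltered.nonempty,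
    ⟨fun _ => ⊤, fun _ _ _ _ => trivial, fun n => by
      have : Subsingleton (Quotient (⊤ : Setoid ((X.diag.obj
          (Classical.choice IsCofiltered.nonempty)).obj n))) :=
        ⟨by rintro ⟨x⟩ ⟨y⟩; exact Quotient.sound trivial⟩
      infer_instance⟩⟩⟩
  cone_objs a b :=
    ⟨⟨IsCofiltered.min a.idx b.idx,
      (a.quot.comap (X.diag.map (IsCofiltered.minToLeft _ _))).inf
        (b.quot.comap (X.diag.map (IsCofiltered.minToRight _ _)))⟩,
      ofComap a _ _ fun _ _ _ h => h.1, ofComap b _ _ fun _ _ _ h => h.2, trivial⟩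
  cone_maps a b f g :=
    ⟨⟨IsCofiltered.eq f.hom g.hom, a.quot.comap (X.diag.map (IsCofiltered.eqHom _ _))⟩,
      ofComap a _ _ fun _ _ _ h => h, Hom.ext (IsCofiltered.eq_condition f.hom g.hom)⟩

end FinIndex

/-- The pro-simplicial finite set `Fin X`: the system of all simplicial finite quotients of all
`X_s`, that is, the cofiltered limit over `s` of the systems of simplicial finite quotients
of `X_s`. -/
def finObj (X : Pro SSet.{u}) : Pro (SimplicialObject FintypeCat.{u}) where
  Index := FinIndex X
  diag :=
    { obj a := a.quot.obj
      map {a b} f := a.quot.lift (X.diag.map f.hom ≫ b.quot.proj) fun n x y h =>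
        Quotient.sound (f.rel n x y h)
      map_id a := by
        ext n x
        induction x using Quotient.inductionOn with | h x =>
        exact congrArg (fun k : X.diag.obj a.idx ⟶ X.diag.obj a.idx => Quotient.mk (a.quot.rel n) ((NatTrans.app k n).hom x))
          (X.diag.map_id a.idx)
      map_comp {a b c} f g := by
        ext n x
        induction x using Quotient.inductionOn with | h x =>
        exact congrArg (fun k : X.diag.obj a.idx ⟶ X.diag.obj c.idx => Quotient.mk (c.quot.rel n) ((NatTrans.app k n).hom x))
          (X.diag.map_comp f.hom g.hom) }

/-- The comparison `colim Hom (Q, A) → colim_s Hom (X_s, A)`, the first colimit being over the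
simplicial finite quotients `Q` of the `X_s`. -/
noncomputable def finMaps (X : Pro SSet.{u}) (A : SimplicialObject FintypeCat.{u}) :
    (finObj X).maps.obj A → X.maps.obj (simplicialFiniteIncl.obj A) :=
  (finObj X).desc (fun a g => X.germ (a.quot.proj ≫ simplicialFiniteIncl.map g))
    (fun {_ b} f g => X.germ_map f.hom (b.quot.proj ≫ simplicialFiniteIncl.map g))

lemma finMaps_germ (X : Pro SSet.{u}) {A : SimplicialObject FintypeCat.{u}}
    (a : (finObj X).Index) (g : (finObj X).diag.obj a ⟶ A) :
    finMaps X A ((finObj X).germ g) = X.germ (a.quot.proj ≫ simplicialFiniteIncl.map g) :=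
  (finObj X).desc_germ (fun a g => X.germ (a.quot.proj ≫ simplicialFiniteIncl.map g))
    (fun {_ b} f g => X.germ_map f.hom (b.quot.proj ≫ simplicialFiniteIncl.map g)) g

lemma finMaps_map (X : Pro SSet.{u}) {A B : SimplicialObject FintypeCat.{u}} (f : A ⟶ B)
    (x : (finObj X).maps.obj A) :
    finMaps X B ((finObj X).maps.map f x) =
      X.maps.map (simplicialFiniteIncl.map f) (finMaps X A x) := by
  obtain ⟨a, g, rfl⟩ := germ_surj _ x
  rw [maps_map_germ, finMaps_germ, finMaps_germ, maps_map_germ]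
  rfl

lemma finMaps_bijective (X : Pro SSet.{u}) (A : SimplicialObject FintypeCat.{u}) :
    Function.Bijective (finMaps X A) := by
  constructor
  · intro x y h
    obtain ⟨a, g, rfl⟩ := germ_surj _ x
    obtain ⟨b, g', rfl⟩ := germ_surj _ y
    rw [finMaps_germ, finMaps_germ, germ_eq_iff] at h
    obtain ⟨r, u, v, h⟩ := h
    let c : FinIndex X := ⟨r, (a.quot.comap (X.diag.map u)).inf (b.quot.comap (X.diag.map v))⟩
    let α : c ⟶ a := FinIndex.ofComap a u _ fun _ _ _ h => h.1
    let β : c ⟶ b := FinIndex.ofComap b v _ fun _ _ _ h => h.2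
    refine (germ_eq_iff _ _ _).2 ⟨c, α, β, c.quot.hom_ext ?_⟩
    exact h
  · intro y
    obtain ⟨s, f, rfl⟩ := germ_surj _ y
    let a : FinIndex X := ⟨s, SimplicialFiniteQuotient.ofHom f⟩
    refine ⟨(finObj X).germ (t := a) (a.quot.lift f fun n x y h => h), ?_⟩
    exact finMaps_germ X a _

/-- The bijection `Hom (Fin X, Y) ≃ Hom (X, i Y)`. -/
noncomputable def finHomEquiv (X : Pro SSet.{u}) (Y : Pro (SimplicialObject FintypeCat.{u})) :
    (finObj X ⟶ Y) ≃ (X ⟶ (map simplicialFiniteIncl).obj Y) where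
  toFun φ :=
    { val s := finMaps X _ (φ.val s)
      compat a := by
        rw [← φ.compat a, finMaps_map]
        rfl }
  invFun ψ :=
    { val s := (Equiv.ofBijective _ (finMaps_bijective X (Y.diag.obj s))).symm (ψ.val s)
      compat {s s'} a := by
        apply (finMaps_bijective X _).1
        rw [finMaps_map]
        have h (s) := (Equiv.ofBijective _
          (finMaps_bijective X (Y.diag.obj s))).apply_symm_apply (ψ.val s)
        simp only [Equiv.ofBijective_apply] at h
        rw [h, h]
        exact ψ.compat a }
  left_inv φ := by
    ext s
    exact (Equiv.ofBijective _ (finMaps_bijective X (Y.diag.obj s))).symm_apply_apply (φ.val s)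
  right_inv ψ := by
    ext s
    exact (Equiv.ofBijective _ (finMaps_bijective X (Y.diag.obj s))).apply_symm_apply (ψ.val s)

lemma finHomEquiv_comp (X : Pro SSet.{u}) (Y Y' : Pro (SimplicialObject FintypeCat.{u}))
    (g : Y ⟶ Y') (h : finObj X ⟶ Y) :
    finHomEquiv X Y' (h ≫ g) = finHomEquiv X Y h ≫ (map simplicialFiniteIncl).map g := by
  ext s
  obtain ⟨t, f, hf⟩ := Y.germ_surj (g.val s)
  change finMaps X _ (h.precomp.app _ (g.val s)) =
    (finHomEquiv X Y h).precomp.app _ (mapMaps simplicialFiniteIncl Y (g.val s))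
  rw [← hf, Hom.precomp_germ, finMaps_map, mapMaps_germ]
  exact (Hom.precomp_germ (finHomEquiv X Y h) (s := t) _).symm

end Pro

/-- The inclusion `i` of pro-simplicial finite sets into pro-simplicial sets. -/
noncomputable abbrev proIncl : Pro (SimplicialObject FintypeCat.{u}) ⥤ Pro SSet.{u} :=
  Pro.map simplicialFiniteIncl

/-- The functor `Fin` from pro-simplicial sets to pro-simplicial finite sets. -/
noncomputable def proFin : Pro SSet.{u} ⥤ Pro (SimplicialObject FintypeCat.{u}) :=
  Adjunction.leftAdjointOfEquiv Pro.finHomEquiv Pro.finHomEquiv_comp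

/-- `Fin` is left adjoint to the inclusion. -/
noncomputable def proFinAdjunction : proFin.{u} ⊣ proIncl :=
  Adjunction.adjunctionOfEquivLeft Pro.finHomEquiv Pro.finHomEquiv_comp

/-- The functor `F` from pro-simplicial finite sets to simplicial pro-finite sets:
`(F X)_n` is the pro-finite set `s ↦ (X_s)_n`. -/
noncomputable def proToSimplicial :
    Pro (SimplicialObject FintypeCat.{u}) ⥤ SimplicialObject (Pro FintypeCat.{u}) :=
  (evaluation SimplexCategoryᵒᵖ FintypeCat.{u} ⋙ Pro.mapFunctor).flip


namespace Pro

section Flat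

variable {C : Type u₁} [Category.{v} C]

instance maps_preservesFiniteLimits (X : Pro C) : PreservesFiniteLimits X.maps := by
  have : PreservesFiniteLimits (yoneda ⋙ (Functor.whiskeringLeft _ _ _).obj X.diag.op ⋙
      colim : C ⥤ Type v) := by
    have : PreservesFiniteLimits (colim : (X.Indexᵒᵖ ⥤ Type v) ⥤ Type v) := inferInstance
    have : PreservesFiniteLimits ((Functor.whiskeringLeft _ _ (Type v)).obj X.diag.op) :=
      ⟨fun _ => inferInstance⟩
    have : PreservesFiniteLimits (yoneda : C ⥤ _) := ⟨fun _ => inferInstance⟩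
    infer_instance
  exact preservesFiniteLimits_of_natIso (NatIso.ofComponents (fun A => Iso.refl _) :
    yoneda ⋙ (Functor.whiskeringLeft _ _ _).obj X.diag.op ⋙ colim ≅ X.maps)

/-- Morphisms from a pro-object `X` to a constant one are elements of `colim_t Hom_C (X_t, A)`. -/
noncomputable def homConstEquiv (X : Pro C) (A : C) : (X ⟶ const.obj A) ≃ X.maps.obj A where
  toFun φ := φ.val ⟨⟨⟩⟩
  invFun x :=
    { val _ := x
      compat _ := Functor.map_id_apply X.maps _ x }
  left_inv _ := rfl
  right_inv _ := rfl

lemma homConstEquiv_comp (X : Pro C) {A B : C} (g : A ⟶ B) (φ : X ⟶ const.obj A) :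
    homConstEquiv X B (φ ≫ const.map g) = X.maps.map g (homConstEquiv X A φ) :=
  Hom.precomp_germ φ (s := ⟨⟨⟩⟩) g

instance const_preservesFiniteLimits : PreservesFiniteLimits (const : C ⥤ Pro C) where
  preservesFiniteLimits _ _ _ :=
    { preservesLimit {K} :=
        { preserves {c} hc := ⟨coyonedaJointlyReflectsLimits _ _ fun X => by
            have e : const ⋙ coyoneda.obj X ≅ X.unop.maps :=
              NatIso.ofComponents (fun A => (homConstEquiv X.unop A).toIso) (fun g => by
                ext φ
                exact homConstEquiv_comp X.unop g φ)
            have : PreservesFiniteLimits (const ⋙ coyoneda.obj X) :=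
              preservesFiniteLimits_of_natIso e.symm
            exact isLimitOfPreserves (const ⋙ coyoneda.obj X) hc⟩ } }

end Flat

end Pro

/-- The inclusion of the small skeleton of the category of simplicial finite sets. -/
abbrev skeletonIncl :
    SimplicialObject FintypeCat.Skeleton.{u} ⥤ SimplicialObject FintypeCat.{u} :=
  (Functor.whiskeringRight _ _ _).obj FintypeCat.Skeleton.incl

/-- Simplicial objects in the standard small skeleton of the category of finite sets, as
simplicial pro-finite sets `F (c Z)`. -/
noncomputable abbrev skeletonToSimplicialPro :
    SimplicialObject FintypeCat.Skeleton.{u} ⥤ SimplicialObject (Pro FintypeCat.{u}) :=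
  skeletonIncl ⋙ Pro.const ⋙ proToSimplicial

instance : HasFiniteLimits FintypeCat.Skeleton.{u} where
  out _ _ _ := Adjunction.hasLimitsOfShape_of_equivalence FintypeCat.Skeleton.incl

lemma proToSimplicial_const_map_app_val {A B : SimplicialObject FintypeCat.{u}} (g : A ⟶ B)
    (n : SimplexCategoryᵒᵖ) (j : Discrete PUnit.{u + 1}) :
    ((proToSimplicial.map (Pro.const.map g)).app n).val j =
      (Pro.constObj (A.obj n)).germ (t := ⟨⟨⟩⟩) (g.app n) :=
  Pro.mapMaps_germ ((evaluation SimplexCategoryᵒᵖ FintypeCat.{u}).obj n) (Pro.constObj A)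
    (t := ⟨⟨⟩⟩) g

instance : PreservesFiniteLimits skeletonToSimplicialPro.{u} := by
  have e : (Functor.whiskeringRight SimplexCategoryᵒᵖ _ _).obj
      (FintypeCat.Skeleton.incl.{u} ⋙ Pro.const) ≅ skeletonToSimplicialPro :=
    NatIso.ofComponents (fun A => NatIso.ofComponents (fun n => Iso.refl _) (fun f => by
      refine (Category.comp_id _).trans (Eq.trans ?_ (Category.id_comp _).symm)
      rfl)) (fun f => by
      refine NatTrans.ext (funext fun n => ?_)
      refine (Category.comp_id _).trans (Eq.trans ?_ (Category.id_comp _).symm)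
      exact Pro.hom_ext fun j => (proToSimplicial_const_map_app_val (skeletonIncl.map f) n j).symm)
  have : PreservesFiniteLimits ((Functor.whiskeringRight SimplexCategoryᵒᵖ _ _).obj
      (FintypeCat.Skeleton.incl.{u} ⋙ Pro.const)) := ⟨fun _ => inferInstance⟩
  exact preservesFiniteLimits_of_natIso e

instance : RepresentablyFlat skeletonToSimplicialPro.{u} :=
  flat_of_preservesFiniteLimits _

lemma exists_skeleton_iso (A : SimplicialObject FintypeCat.{u}) :
    ∃ Z : SimplicialObject FintypeCat.Skeleton.{u}, Nonempty (A ≅ skeletonIncl.obj Z) :=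
  ⟨A ⋙ FintypeCat.Skeleton.incl.inv, ⟨NatIso.ofComponents
    (fun n => (FintypeCat.Skeleton.incl.asEquivalence.counitIso.app (A.obj n)).symm)
    (fun f => (FintypeCat.Skeleton.incl.asEquivalence.counitIso.inv.naturality (A.map f)))⟩⟩

namespace Pro

/-- The pro-simplicial finite set `G Y`: the system of all simplicial finite sets `Z` (in the
small skeleton) equipped with a map `Y ⟶ F (c Z)`. -/
noncomputable abbrev ofSimplicialObj (Y : SimplicialObject (Pro FintypeCat.{u})) :
    Pro (SimplicialObject FintypeCat.{u}) where
  Index := StructuredArrow Y skeletonToSimplicialPro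
  diag := StructuredArrow.proj _ _ ⋙ skeletonIncl

variable (Y : SimplicialObject (Pro FintypeCat.{u}))


lemma ofSimplicial_aux {A : SimplicialObject FintypeCat.{u}}
    {a b : StructuredArrow Y skeletonToSimplicialPro} (f : a ⟶ b)
    (g : skeletonIncl.obj b.right ⟶ A) :
    a.hom ≫ proToSimplicial.map (const.map (skeletonIncl.map f.right ≫ g)) =
      b.hom ≫ proToSimplicial.map (const.map g) :=
  (congrArg (a.hom ≫ ·) ((const ⋙ proToSimplicial).map_comp (skeletonIncl.map f.right) g)).trans
    ((Category.assoc _ _ _).symm.trans (congrArg (· ≫ _) (StructuredArrow.w f)))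

/-- The comparison `colim Hom (Z, A) → Hom (Y, F (c A))`, the colimit being over the simplicial
finite sets `Z` with a map `Y ⟶ F (c Z)`. -/
noncomputable def ofSimplicialMaps (A : SimplicialObject FintypeCat.{u}) :
    (ofSimplicialObj Y).maps.obj A → (Y ⟶ proToSimplicial.obj (const.obj A)) :=
  (ofSimplicialObj Y).desc
    (fun (a : StructuredArrow Y skeletonToSimplicialPro) g =>
      a.hom ≫ proToSimplicial.map (const.map g))
    (fun f g => ofSimplicial_aux _ f g)

lemma ofSimplicialMaps_germ {A : SimplicialObject FintypeCat.{u}}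
    (a : StructuredArrow Y skeletonToSimplicialPro) (g : skeletonIncl.obj a.right ⟶ A) :
    ofSimplicialMaps Y A ((ofSimplicialObj Y).germ (t := a) g) =
      a.hom ≫ proToSimplicial.map (const.map g) :=
  (ofSimplicialObj Y).desc_germ
    (fun (a : StructuredArrow Y skeletonToSimplicialPro) g =>
      a.hom ≫ proToSimplicial.map (const.map g))
    (fun f g => ofSimplicial_aux _ f g) g

lemma ofSimplicialMaps_map {A B : SimplicialObject FintypeCat.{u}} (f : A ⟶ B)
    (x : (ofSimplicialObj Y).maps.obj A) :
    ofSimplicialMaps Y B ((ofSimplicialObj Y).maps.map f x) =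
      ofSimplicialMaps Y A x ≫ proToSimplicial.map (const.map f) := by
  obtain ⟨a, g, rfl⟩ := germ_surj _ x
  rw [maps_map_germ]
  refine (ofSimplicialMaps_germ Y a _).trans (Eq.trans ?_
    (congrArg (· ≫ _) (ofSimplicialMaps_germ Y a _).symm))
  exact (congrArg (a.hom ≫ ·) ((const ⋙ proToSimplicial).map_comp g f)).trans
    (Category.assoc _ _ _).symm

lemma ofSimplicialMaps_bijective (A : SimplicialObject FintypeCat.{u}) :
    Function.Bijective (ofSimplicialMaps Y A) := by
  obtain ⟨Z, ⟨i⟩⟩ := exists_skeleton_iso A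
  constructor
  · have key (a : StructuredArrow Y skeletonToSimplicialPro) (g : skeletonIncl.obj a.right ⟶ A)
        (ψ : Y ⟶ proToSimplicial.obj (const.obj A))
        (h : a.hom ≫ proToSimplicial.map (const.map g) = ψ) :
        (ofSimplicialObj Y).germ (t := a) g =
          (ofSimplicialObj Y).germ (t := StructuredArrow.mk (S := Y) (Y := Z)
            (T := skeletonToSimplicialPro) (ψ ≫ proToSimplicial.map (const.map i.hom))) i.inv := by
      let b := StructuredArrow.mk (S := Y) (Y := Z) (T := skeletonToSimplicialPro)
        (ψ ≫ proToSimplicial.map (const.map i.hom))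
      let k : a.right ⟶ Z :=
        { app n := FintypeCat.Skeleton.incl.preimage ((g ≫ i.hom).app n)
          naturality m n θ := FintypeCat.Skeleton.incl.map_injective (by
            simp only [Functor.map_comp, Functor.map_preimage]
            exact (g ≫ i.hom).naturality θ) }
      have hk : skeletonIncl.map k = g ≫ i.hom :=
        NatTrans.ext (funext fun n => FintypeCat.Skeleton.incl.map_preimage _)
      let α : a ⟶ b := StructuredArrow.homMk k (by
        change a.hom ≫ proToSimplicial.map (const.map (skeletonIncl.map k)) = _
        rw [hk, Functor.map_comp, Functor.map_comp, ← Category.assoc, h]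
        rfl)
      refine Eq.trans ?_ (germ_map (ofSimplicialObj Y) (s := a) (t := b) α i.inv)
      refine congrArg ((ofSimplicialObj Y).germ (t := a)) ?_
      change g = skeletonIncl.map k ≫ i.inv
      rw [hk, Category.assoc, i.hom_inv_id, Category.comp_id]
    intro x y h
    obtain ⟨a, g, rfl⟩ := germ_surj _ x
    obtain ⟨b, g', rfl⟩ := germ_surj _ y
    have h1 := ofSimplicialMaps_germ Y a g
    have h2 := ofSimplicialMaps_germ Y b g'
    exact (key a g _ h1.symm).trans (h ▸ (key b g' _ h2.symm).symm)
  · intro ψ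
    refine ⟨(ofSimplicialObj Y).germ (t := StructuredArrow.mk (S := Y) (Y := Z)
            (T := skeletonToSimplicialPro) (ψ ≫ proToSimplicial.map (const.map i.hom))) i.inv, ?_⟩
    refine (ofSimplicialMaps_germ Y _ _).trans ?_
    refine (Category.assoc _ _ _).trans ?_
    refine Eq.trans (congrArg (ψ ≫ ·) ?_) (Category.comp_id _)
    exact ((const ⋙ proToSimplicial).mapIso i).hom_inv_id

variable {Y}

lemma app_val_comp_const {A B : SimplicialObject FintypeCat.{u}}
    (ψ : Y ⟶ proToSimplicial.obj (const.obj A)) (g : A ⟶ B) (n : SimplexCategoryᵒᵖ) (j : Discrete PUnit.{u + 1}) :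
    ((ψ ≫ proToSimplicial.map (const.map g)).app n).val j =
      (Y.obj n).maps.map (g.app n) ((ψ.app n).val ⟨⟨⟩⟩) :=
  (congrArg ((ψ.app n).precomp.app (B.obj n)) (proToSimplicial_const_map_app_val g n j)).trans
    (Hom.precomp_germ (ψ.app n) (s := ⟨⟨⟩⟩) (g.app n))

lemma app_val_naturality {X : Pro (SimplicialObject FintypeCat.{u})}
    (ψ : Y ⟶ proToSimplicial.obj X) {m n : SimplexCategoryᵒᵖ} (θ : m ⟶ n) (s : X.Index) :
    (Y.map θ).precomp.app _ ((ψ.app n).val s) =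
      (Y.obj m).maps.map ((X.diag.obj s).map θ) ((ψ.app m).val s) :=
  (congrArg (fun k : Y.obj m ⟶ (proToSimplicial.obj X).obj n => k.val s) (ψ.naturality θ)).trans
    (Hom.precomp_germ (ψ.app m) (s := s) ((X.diag.obj s).map θ))

/-- The canonical map from a pro-object `X` to the constant pro-object on `X_s`. -/
noncomputable def toConst {C : Type u₁} [Category.{v} C] (X : Pro C) (s : X.Index) :
    X ⟶ const.obj (X.diag.obj s) :=
  (homConstEquiv X _).symm (X.germ (𝟙 _))

lemma app_val_comp_toConst {X : Pro (SimplicialObject FintypeCat.{u})}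
    (ψ : Y ⟶ proToSimplicial.obj X) (s : X.Index) (n : SimplexCategoryᵒᵖ) (j : Discrete PUnit.{u + 1}) :
    ((ψ ≫ proToSimplicial.map (X.toConst s)).app n).val j = (ψ.app n).val s := by
  have h := mapMaps_germ ((evaluation SimplexCategoryᵒᵖ FintypeCat.{u}).obj n) X (t := s) (𝟙 _)
  refine (congrArg ((ψ.app n).precomp.app ((X.diag.obj s).obj n)) h).trans ?_
  exact (Hom.precomp_germ (ψ.app n) (s := s) (𝟙 _)).trans
    (Functor.map_id_apply (Y.obj n).maps _ _)

lemma toConst_comp {C : Type u₁} [Category.{v} C] (X : Pro C) {s s' : X.Index} (a : s ⟶ s') :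
    X.toConst s ≫ const.map (X.diag.map a) = X.toConst s' := by
  apply (homConstEquiv X _).injective
  rw [homConstEquiv_comp]
  refine (maps_map_germ _ _ _).trans ?_
  rw [Category.id_comp, ← Category.comp_id (X.diag.map a)]
  exact germ_map X a _

/-- The component at `n` of the map `Y ⟶ F X` corresponding to a map `G Y ⟶ X`. -/
noncomputable def ofSimplicialHomApp {Y : SimplicialObject (Pro FintypeCat.{u})}
    {X : Pro (SimplicialObject FintypeCat.{u})} (φ : ofSimplicialObj Y ⟶ X)
    (n : SimplexCategoryᵒᵖ) : Y.obj n ⟶ (proToSimplicial.obj X).obj n where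
  val s := ((ofSimplicialMaps Y _ (φ.val s)).app n).val ⟨⟨⟩⟩
  compat {s s'} a := by
    rw [← φ.compat a, ofSimplicialMaps_map]
    exact (app_val_comp_const _ _ _ _).symm

/-- The bijection `Hom (G Y, X) ≃ Hom (Y, F X)`. -/
noncomputable def ofSimplicialHomEquiv (Y : SimplicialObject (Pro FintypeCat.{u}))
    (X : Pro (SimplicialObject FintypeCat.{u})) :
    (ofSimplicialObj Y ⟶ X) ≃ (Y ⟶ proToSimplicial.obj X) where
  toFun φ :=
    { app n := ofSimplicialHomApp φ n
      naturality m n θ := by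
        refine Pro.hom_ext fun (s : X.Index) => ?_
        exact (app_val_naturality (ofSimplicialMaps Y _ (φ.val s)) θ ⟨⟨⟩⟩).trans
          (Hom.precomp_germ (ofSimplicialHomApp φ m) (s := s) ((X.diag.obj s).map θ)).symm }
  invFun ψ :=
    { val s := (Equiv.ofBijective _ (ofSimplicialMaps_bijective Y _)).symm
        (ψ ≫ proToSimplicial.map (X.toConst s))
      compat {s s'} a := by
        apply (ofSimplicialMaps_bijective Y _).1
        rw [ofSimplicialMaps_map]
        have h (s) := (Equiv.ofBijective _ (ofSimplicialMaps_bijective Y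
          (X.diag.obj s))).apply_symm_apply (ψ ≫ proToSimplicial.map (X.toConst s))
        simp only [Equiv.ofBijective_apply] at h
        rw [h, h, Category.assoc, ← Functor.map_comp, toConst_comp] }
  left_inv φ := by
    ext s
    apply (Equiv.ofBijective _ (ofSimplicialMaps_bijective Y _)).symm_apply_eq.2
    refine NatTrans.ext (funext fun n => Pro.hom_ext fun j => ?_)
    exact app_val_comp_toConst _ s n j
  right_inv ψ := by
    refine NatTrans.ext (funext fun n => Pro.hom_ext fun (s : X.Index) => ?_)
    have h := (Equiv.ofBijective _ (ofSimplicialMaps_bijective Y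
      (X.diag.obj s))).apply_symm_apply (ψ ≫ proToSimplicial.map (X.toConst s))
    simp only [Equiv.ofBijective_apply] at h
    exact (congrArg (fun k : Y ⟶ proToSimplicial.obj (const.obj (X.diag.obj s)) =>
      (k.app n).val ⟨⟨⟩⟩) h).trans
      (app_val_comp_toConst ψ s n ⟨⟨⟩⟩)

lemma ofSimplicialHomEquiv_comp (Y : SimplicialObject (Pro FintypeCat.{u}))
    (X X' : Pro (SimplicialObject FintypeCat.{u})) (g : X ⟶ X') (h : ofSimplicialObj Y ⟶ X) :
    ofSimplicialHomEquiv Y X' (h ≫ g) =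
      ofSimplicialHomEquiv Y X h ≫ proToSimplicial.map g := by
  refine NatTrans.ext (funext fun n => Pro.hom_ext fun (s : X'.Index) => ?_)
  obtain ⟨t, f, hf⟩ := X.germ_surj (g.val s)
  have h1 : (h ≫ g).val s = (ofSimplicialObj Y).maps.map f (h.val t) := by
    rw [comp_val, ← hf, Hom.precomp_germ]
  have h2 : ((proToSimplicial.map g).app n).val s = germ ((proToSimplicial.obj X).obj n)
      (t := t) (f.app n) :=
    (congrArg (mapMaps ((evaluation SimplexCategoryᵒᵖ FintypeCat.{u}).obj n) X) hf.symm).trans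
      (mapMaps_germ _ X f)
  change ((ofSimplicialMaps Y _ ((h ≫ g).val s)).app n).val ⟨⟨⟩⟩ =
    ((ofSimplicialHomEquiv Y X h).app n).precomp.app _ (((proToSimplicial.map g).app n).val s)
  rw [h1, ofSimplicialMaps_map, h2]
  exact (app_val_comp_const _ f n ⟨⟨⟩⟩).trans
    (Hom.precomp_germ ((ofSimplicialHomEquiv Y X h).app n) (s := t) (f.app n)).symm

end Pro

/-- The functor `G` from simplicial pro-finite sets to pro-simplicial finite sets. -/
noncomputable def simplicialToPro :
    SimplicialObject (Pro FintypeCat.{u}) ⥤ Pro (SimplicialObject FintypeCat.{u}) :=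
  Adjunction.leftAdjointOfEquiv Pro.ofSimplicialHomEquiv Pro.ofSimplicialHomEquiv_comp

/-- `G` is left adjoint to `F`. -/
noncomputable def simplicialToProAdjunction : simplicialToPro.{u} ⊣ proToSimplicial :=
  Adjunction.adjunctionOfEquivLeft Pro.ofSimplicialHomEquiv Pro.ofSimplicialHomEquiv_comp

/-- The contravariant functor `A ↦ (A → ℤ/p)`. -/
def functionsZMod (p : ℕ) : (Type u)ᵒᵖ ⥤ ModuleCat.{u} (ZMod p) where
  obj A := ModuleCat.of (ZMod p) (A.unop → ZMod p)
  map f := ModuleCat.ofHom (LinearMap.funLeft (ZMod p) (ZMod p) f.unop)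

/-- For a contravariant functor `H` on `C` with values in `ℤ/p`-modules, the `n`-th cohomology
of the cochain complex `k ↦ H (X_k)` of a simplicial object `X` of `C`, whose differential is the
alternating sum of the maps induced by the faces of `X`. -/
noncomputable def simplicialCohomology {p : ℕ} {C : Type u₁} [Category.{v} C]
    (H : Cᵒᵖ ⥤ ModuleCat.{u} (ZMod p)) (n : ℕ) :
    (SimplicialObject C)ᵒᵖ ⥤ ModuleCat.{u} (ZMod p) :=
  (simplicialCosimplicialEquiv C).functor ⋙ (CosimplicialObject.whiskering _ _).obj H ⋙
    AlgebraicTopology.alternatingCofaceMapComplex _ ⋙ HomologicalComplex.homologyFunctor _ _ n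

/-- The cohomology `H^n (X; ℤ/p) = colim_s H^n (X_s; ℤ/p)` of a pro-simplicial set. -/
noncomputable def proCohomology (p n : ℕ) : (Pro SSet.{u})ᵒᵖ ⥤ ModuleCat.{u} (ZMod p) :=
  Pro.extend (simplicialCohomology (functionsZMod p) n)

/-- The continuous cohomology `H^n (Y; ℤ/p)` of a simplicial pro-finite set: the cohomology of
the cochain complex `k ↦ colim_t Hom ((Y_k)_t, ℤ/p)` of continuous functions. -/
noncomputable def proFiniteCohomology (p n : ℕ) :
    (SimplicialObject (Pro FintypeCat.{u}))ᵒᵖ ⥤ ModuleCat.{u} (ZMod p) :=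
  simplicialCohomology (Pro.extend (FintypeCat.incl.op ⋙ functionsZMod p)) n

/-- The `ℤ/p`-cohomology weak equivalences of pro-simplicial sets. -/
def proWeakEquivalences (p : ℕ) : MorphismProperty (Pro SSet.{u}) :=
  fun _ _ f => ∀ n : ℕ, IsIso ((proCohomology p n).map f.op)

/-- The continuous `ℤ/p`-cohomology isomorphisms of simplicial pro-finite sets. -/
def simplicialProWeakEquivalences (p : ℕ) :
    MorphismProperty (SimplicialObject (Pro FintypeCat.{u})) :=
  fun _ _ f => ∀ n : ℕ, IsIso ((proFiniteCohomology p n).map f.op)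

/-- The functor between localizations induced by a functor `T` that carries `W` to `W'`: the unique
functor that makes the square formed by `T` and the two localization functors commute. -/
noncomputable def hoFunctor {C : Type u₁} [Category.{v} C] {D : Type u₂} [Category.{w} D]
    {W : MorphismProperty C} {W' : MorphismProperty D} (T : C ⥤ D)
    (hT : W ≤ W'.inverseImage T) : W.Localization ⥤ W'.Localization :=
  Localization.Construction.lift (T ⋙ W'.Q) fun _ _ f hf => W'.Q_inverts (T.map f) (hT f hf)

/-- The homotopy category `Ho (pro-sSet)`: the localization of the category of pro-simplicial sets
at the `ℤ/p`-cohomology weak equivalences. -/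
abbrev HoPro (p : ℕ) : Type (u + 1) := (proWeakEquivalences.{u} p).Localization

/-- The homotopy category `Ho (s pro-F)`: the localization of the category of simplicial
pro-finite sets at the continuous `ℤ/p`-cohomology isomorphisms. -/
abbrev HoSimplicialPro (p : ℕ) : Type (u + 1) := (simplicialProWeakEquivalences.{u} p).Localization

/-! The comparison passes through pro-simplicial finite sets. On that category the functors
`proIncl` (i) and `proToSimplicial` (F) detect the same weak equivalences: for a pro-simplicial
finite set X, the continuous cochains of F X are by construction the filtered colimit of the
cochains of the X_s, and taking cohomology commutes with filtered colimits because these are exact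
on modules. This is `proToSimplicial_weakEquivalence_iff`.

The two adjunction units X ⟶ i Fin X and Y ⟶ F G Y are isomorphisms already on cochains in each
degree, before cohomology is taken. The reason is the finiteness of ℤ/p: an m-cochain on K is the
same as a map of simplicial sets from K to the degreewise finite k ↦ (ℤ/p)^Hom(m, k), the cofree
object on ℤ/p in degree m. Hence a cochain on X_s descends to a simplicial finite quotient of X_s,
and a continuous m-cochain on Y is a map from Y to F of a constant pro-object, which is exactly what
the system G Y records. These two facts are `isIso_extendMap_of_val_eq_germ_proj` and
`Pro.isIso_extendMap_of_val_eq`.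

The rest is formal. The triangle identities and two-out-of-three show that i and F send both counits
to weak equivalences. Naturality of the units shows that F ∘ Fin and i ∘ G preserve weak
equivalences. The zigzags X ⟶ i Fin X ⟵ i G F Fin X and Y ⟶ F G Y ⟵ F Fin i G Y then become natural
isomorphisms after localization. -/

/-! ### Cohomology commutes with filtered colimits -/

namespace CategoryTheory.ShortComplex

section

variable {J : Type*} [Category* J] {A : Type*} [Category* A] [Abelian A]
  [HasColimitsOfShape J A]

/-- The canonical natural transformation from evaluation at `j` to `colim`. -/
noncomputable def evaluationToColim (j : J) :
    (evaluation J A).obj j ⟶ (colim : (J ⥤ A) ⥤ A) where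
  app F := colimit.ι F j

/-- The cocone over a diagram of short complexes given by the termwise colimit. -/
noncomputable def colimCocone (F : J ⥤ ShortComplex A) : Cocone F where
  pt := ((FunctorEquivalence.inverse J A).obj F).map colim
  ι :=
    { app j := ((FunctorEquivalence.inverse J A).obj F).mapNatTrans (evaluationToColim j)
      naturality i j f := by
        ext
        · exact (colimit.w (F ⋙ π₁) f).trans (Category.comp_id _).symm
        · exact (colimit.w (F ⋙ π₂) f).trans (Category.comp_id _).symm
        · exact (colimit.w (F ⋙ π₃) f).trans (Category.comp_id _).symm }

/-- The termwise colimit of short complexes is a colimit. -/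
noncomputable def isColimitColimCocone (F : J ⥤ ShortComplex A) : IsColimit (colimCocone F) :=
  isColimitOfIsColimitπ _
    (IsColimit.ofIsoColimit (colimit.isColimit (F ⋙ π₁))
      (Cocone.ext (Iso.refl _) (fun _ => Category.comp_id _)))
    (IsColimit.ofIsoColimit (colimit.isColimit (F ⋙ π₂))
      (Cocone.ext (Iso.refl _) (fun _ => Category.comp_id _)))
    (IsColimit.ofIsoColimit (colimit.isColimit (F ⋙ π₃))
      (Cocone.ext (Iso.refl _) (fun _ => Category.comp_id _)))

/-- A diagram of short complexes is one short complex S in `J ⥤ A`. Evaluation at j and `colim` are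
both exact, so each commutes with the homology of S. Naturality of these comparisons along
`evaluationToColim j` identifies the homology of the termwise colimit cocone with the colimit cocone
of the homologies. -/
instance preservesColimitsOfShape_homologyFunctor [HasExactColimitsOfShape J A] :
    PreservesColimitsOfShape J (homologyFunctor A) where
  preservesColimit {F} := by
    let S := (FunctorEquivalence.inverse J A).obj F
    have : (colim : (J ⥤ A) ⥤ A).PreservesHomology := inferInstance
    have (j : J) : ((evaluation J A).obj j).PreservesHomology := inferInstance
    let e : S.homology ≅ F ⋙ homologyFunctor A :=
      NatIso.ofComponents (fun j => (S.mapHomologyIso ((evaluation J A).obj j)).symm) (fun {i j} f => by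
        have h := NatTrans.app_homology ((evaluation J A).map f) S
        exact (Iso.comp_inv_eq (S.mapHomologyIso ((evaluation J A).obj j))).2
          (h.trans (Category.assoc _ _ _).symm))
    refine preservesColimit_of_preserves_colimit_cocone (isColimitColimCocone F) ?_
    refine (IsColimit.equivOfNatIsoOfIso e (colimit.cocone S.homology)
      ((homologyFunctor A).mapCocone (colimCocone F))
      (Cocone.ext (S.mapHomologyIso (colim : (J ⥤ A) ⥤ A)).symm fun j => ?_)) (colimit.isColimit _)
    have h := NatTrans.app_homology (evaluationToColim j) S
    refine (Iso.comp_inv_eq (S.mapHomologyIso (colim : (J ⥤ A) ⥤ A))).2 ?_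
    refine (congrArg ((S.mapHomologyIso ((evaluation J A).obj j)).hom ≫ ·) h).trans ?_
    exact Iso.hom_inv_id_assoc _ _

end

end CategoryTheory.ShortComplex

/-- Degree n cohomology is the homology of a short complex whose terms are evaluations of the
cosimplicial object, and evaluations preserve colimits. -/
instance preservesColimitsOfShape_cosimplicialCohomology {J : Type*} [Category* J]
    {A : Type*} [Category* A] [Abelian A] [HasColimitsOfShape J A] [HasExactColimitsOfShape J A] (n : ℕ) :
    PreservesColimitsOfShape J (AlgebraicTopology.alternatingCofaceMapComplex A ⋙
      HomologicalComplex.homologyFunctor A (ComplexShape.up ℕ) n) := by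
  let P := AlgebraicTopology.alternatingCofaceMapComplex A ⋙
      HomologicalComplex.shortComplexFunctor A (ComplexShape.up ℕ) n
  have h (k : ℕ) {F : J ⥤ SimplexCategory ⥤ A} {c : Cocone F} (hc : IsColimit c) :
      IsColimit (((CategoryTheory.evaluation SimplexCategory A).obj
        (SimplexCategory.mk k)).mapCocone c) :=
    isColimitOfPreserves ((CategoryTheory.evaluation SimplexCategory A).obj
      (SimplexCategory.mk k)) hc
  -- The three degrees are those before n, at n and after n. For n = 0 the degree before is 0 again,
  -- by the default value of `ComplexShape.prev`, so all three terms are still evaluations.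
  have : PreservesColimitsOfShape J P :=
    ⟨fun {F} => ⟨fun {c} hs => ⟨ShortComplex.isColimitOfIsColimitπ (P.mapCocone c)
      (h (F := F) _ hs) (h (F := F) _ hs) (h (F := F) _ hs)⟩⟩⟩
  exact inferInstanceAs (PreservesColimitsOfShape J (P ⋙ ShortComplex.homologyFunctor A))

/-! ### Cochains of pro-objects and their cohomology -/

namespace Pro

variable {C : Type u₁} [Category.{v} C] {E : Type u₃} [Category.{w} E] [HasColimitsOfSize.{v, v} E]
  {E' : Type u₂} [Category.{w} E'] [HasColimitsOfSize.{v, v} E']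

/-- It suffices to compare on each H (Y_s). There φ is represented by some f : X_t ⟶ Y_s, and both
composites are T (H f) followed by the inclusion of stage t. -/
lemma map_extendMap (H : Cᵒᵖ ⥤ E) (T : E ⥤ E') [PreservesFilteredColimitsOfSize.{v, v} T]
    {X Y : Pro C} (φ : X ⟶ Y) :
    T.map (extendMap H φ) ≫ (preservesColimitIso T (X.diag.op ⋙ H)).hom =
      (preservesColimitIso T (Y.diag.op ⋙ H)).hom ≫ extendMap (H ⋙ T) φ := by
  rw [← Iso.inv_comp_eq]
  refine colimit.hom_ext fun s => ?_
  have h1 := ι_preservesColimitIso_inv T (Y.diag.op ⋙ H) s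
  have h2 := ι_extendMap H φ s.unop
  have h3 := ι_extendMap (H ⋙ T) φ s.unop
  obtain ⟨t, f, hf⟩ := X.germ_surj (φ.val s.unop)
  rw [← hf, pull_germ] at h2 h3
  have h4 := ι_preservesColimitIso_hom T (X.diag.op ⋙ H) (op t)
  refine Eq.trans ?_ h3.symm
  rw [reassoc_of% h1, ← Category.assoc, ← T.map_comp]
  refine (congrArg (· ≫ _) (congrArg T.map h2)).trans ?_
  rw [Functor.map_comp, Category.assoc]
  exact congrArg (_ ≫ ·) h4

/-- The extension to pro-objects commutes with functors that preserve filtered colimits. -/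
noncomputable def extendCompIso (H : Cᵒᵖ ⥤ E) (T : E ⥤ E')
    [PreservesFilteredColimitsOfSize.{v, v} T] : extend H ⋙ T ≅ extend (H ⋙ T) :=
  NatIso.ofComponents (fun X => preservesColimitIso T (X.unop.diag.op ⋙ H))
    (fun φ => map_extendMap H T φ.unop)

end Pro

/-- The cosimplicial object obtained by applying a contravariant functor to a simplicial object. -/
abbrev simplicialToCosimplicial {C : Type u₁} [Category.{v} C] {E : Type u₃} [Category.{w} E]
    (H : Cᵒᵖ ⥤ E) : (SimplicialObject C)ᵒᵖ ⥤ CosimplicialObject E :=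
  (simplicialCosimplicialEquiv C).functor ⋙ (CosimplicialObject.whiskering _ _).obj H

/-- The `n`-th cohomology of the alternating coface map complex of a cosimplicial module. -/
noncomputable abbrev cosimplicialCohomology (p n : ℕ) :
    CosimplicialObject (ModuleCat.{u} (ZMod p)) ⥤ ModuleCat.{u} (ZMod p) :=
  AlgebraicTopology.alternatingCofaceMapComplex _ ⋙
    HomologicalComplex.homologyFunctor _ (ComplexShape.up ℕ) n

/-- Exactness of filtered colimits of ℤ/p-modules is inherited from abelian groups along the
forgetful functor. -/
noncomputable instance (p n : ℕ) :
    PreservesFilteredColimitsOfSize.{u, u} (cosimplicialCohomology.{u} p n) where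
  preserves_filtered_colimits J _ _ := by
    have : HasExactColimitsOfShape J (ModuleCat.{u} (ZMod p)) :=
      HasExactColimitsOfShape.domain_of_functor J (forget₂ _ AddCommGrpCat.{u})
    infer_instance

/-- The cohomology of a pro-simplicial set is that of its cosimplicial module of cochains. -/
noncomputable def proCohomologyIso (p n : ℕ) :
    Pro.extend (simplicialToCosimplicial (functionsZMod.{u} p)) ⋙ cosimplicialCohomology p n ≅
      proCohomology p n :=
  Pro.extendCompIso _ _

/-- The `m`-cochains of a simplicial set. -/
abbrev simplicialCochains (p : ℕ) (m : SimplexCategory) :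
    SSet.{u}ᵒᵖ ⥤ ModuleCat.{u} (ZMod p) :=
  ((CategoryTheory.evaluation SimplexCategoryᵒᵖ (Type u)).obj (op m)).op ⋙ functionsZMod.{u} p

/-- The cohomology of a pro-simplicial set is that of the colimit of the cosimplicial modules of
cochains, and a map of cosimplicial modules is invertible as soon as it is so in each degree. The
criterion is sufficient only; it is meant for the unit of the adjunction between `proFin` and
`proIncl`. -/
lemma proWeakEquivalences_of_cochains {p : ℕ} {X Y : Pro SSet.{u}} (φ : X ⟶ Y)
    (h : ∀ m, IsIso (Pro.extendMap (simplicialCochains.{u} p m) φ)) :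
    proWeakEquivalences p φ := by
  intro n
  rw [← NatIso.isIso_map_iff (proCohomologyIso p n)]
  have h1 (m : SimplexCategory) :
      IsIso ((Pro.extendMap (simplicialToCosimplicial (functionsZMod.{u} p)) φ).app m) := by
    -- Evaluation preserves colimits, so degree m of the colimit is the colimit of the m-cochains,
    -- to which the hypothesis applies.
    let T : CosimplicialObject (ModuleCat.{u} (ZMod p)) ⥤ ModuleCat.{u} (ZMod p) :=
      (CategoryTheory.evaluation SimplexCategory (ModuleCat.{u} (ZMod p))).obj m
    have : PreservesFilteredColimitsOfSize.{u, u} T :=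
      ⟨fun J _ _ => inferInstanceAs (PreservesColimitsOfShape J
        ((CategoryTheory.evaluation SimplexCategory (ModuleCat.{u} (ZMod p))).obj m))⟩
    have e := Pro.extendCompIso (simplicialToCosimplicial (functionsZMod.{u} p)) T
    have h2 : IsIso ((Pro.extend (simplicialToCosimplicial (functionsZMod.{u} p) ⋙ T)).map φ.op) :=
      h m
    exact (NatIso.isIso_map_iff e φ.op).2 h2
  have h2 : IsIso (Pro.extendMap (simplicialToCosimplicial (functionsZMod.{u} p)) φ) :=
    NatIso.isIso_of_isIso_app _
  have h3 : IsIso ((Pro.extend (simplicialToCosimplicial (functionsZMod.{u} p))).map φ.op) := h2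
  exact (cosimplicialCohomology p n).map_isIso _

lemma simplicialProWeakEquivalences_of_cochains {p : ℕ}
    {X Y : SimplicialObject (Pro FintypeCat.{u})} (φ : X ⟶ Y)
    (h : ∀ m, IsIso (Pro.extendMap (FintypeCat.incl.op ⋙ functionsZMod.{u} p) (φ.app m))) :
    simplicialProWeakEquivalences p φ := by
  intro n
  have h1 (m : SimplexCategory) : IsIso (((simplicialToCosimplicial
      (Pro.extend (FintypeCat.incl.op ⋙ functionsZMod.{u} p))).map φ.op).app m) := h (op m)
  have h2 : IsIso ((simplicialToCosimplicial
      (Pro.extend (FintypeCat.incl.op ⋙ functionsZMod.{u} p))).map φ.op) :=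
    NatIso.isIso_of_isIso_app _
  exact (cosimplicialCohomology p n).map_isIso ((simplicialToCosimplicial
      (Pro.extend (FintypeCat.incl.op ⋙ functionsZMod.{u} p))).map φ.op)

/-! ### The cohomology of X and of F X, for X a pro-simplicial finite set -/

section Comparison

variable (p : ℕ)

/-- The cochains of the simplicial finite sets `X_s` with their maps to the continuous cochains
of `F X`. -/
noncomputable def continuousCochainsCocone (X : Pro (SimplicialObject FintypeCat.{u})) :
    Cocone ((proIncl.obj X).diag.op ⋙ simplicialToCosimplicial (functionsZMod.{u} p)) where
  pt := (simplicialToCosimplicial (Pro.extend (FintypeCat.incl.op ⋙ functionsZMod.{u} p))).obj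
    (op (proToSimplicial.obj X))
  ι :=
    { app s :=
        { app m := colimit.ι (((proToSimplicial.obj X).obj (op m)).diag.op ⋙
            FintypeCat.incl.op ⋙ functionsZMod.{u} p) s
          naturality m n θ := ((Pro.ι_extendMap (FintypeCat.incl.op ⋙ functionsZMod.{u} p)
              ((proToSimplicial.obj X).map θ.op) s.unop).trans
                (Pro.pull_germ _ ((proToSimplicial.obj X).obj (op n)) (t := s.unop)
                  ((X.diag.obj s.unop).map θ.op))).symm }
      naturality s t a := by
        refine NatTrans.ext (funext fun m => ?_)
        exact (colimit.w (((proToSimplicial.obj X).obj (op m)).diag.op ⋙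
          FintypeCat.incl.op ⋙ functionsZMod.{u} p) a).trans (Category.comp_id _).symm }

/-- The continuous cochains of `F X` are the colimit of the cochains of the `X_s`. -/
noncomputable def continuousCochainsIsColimit (X : Pro (SimplicialObject FintypeCat.{u})) :
    IsColimit (continuousCochainsCocone p X) :=
  -- Colimits of cosimplicial modules are computed degreewise, and in degree m the cocone is by
  -- definition the colimit defining the continuous functions on (F X)_m.
  evaluationJointlyReflectsColimits _ fun m =>
    IsColimit.ofIsoColimit (colimit.isColimit (((proToSimplicial.obj X).obj (op m)).diag.op ⋙
      FintypeCat.incl.op ⋙ functionsZMod.{u} p)) (Cocone.ext (Iso.refl _) fun _ => by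
        exact Category.comp_id _)

/-- The comparison of the cochains of `X` and the continuous cochains of `F X`. -/
noncomputable def continuousCochainsIso (X : Pro (SimplicialObject FintypeCat.{u})) :
    colimit ((proIncl.obj X).diag.op ⋙ simplicialToCosimplicial (functionsZMod.{u} p)) ≅
      (simplicialToCosimplicial (Pro.extend (FintypeCat.incl.op ⋙ functionsZMod.{u} p))).obj
        (op (proToSimplicial.obj X)) :=
  (colimit.isColimit _).coconePointUniqueUpToIso (continuousCochainsIsColimit p X)

lemma ι_continuousCochainsIso (X : Pro (SimplicialObject FintypeCat.{u})) (s : X.Index) :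
    colimit.ι ((proIncl.obj X).diag.op ⋙ simplicialToCosimplicial (functionsZMod.{u} p)) (op s) ≫
      (continuousCochainsIso p X).hom = (continuousCochainsCocone p X).ι.app (op s) :=
  IsColimit.comp_coconePointUniqueUpToIso_hom _ _ _

/-- Once φ is represented at s by f : X_t ⟶ Y_s, both composites restricted to the cochains of Y_s
are pullback along f followed by the inclusion of stage t. -/
lemma continuousCochainsIso_naturality {X Y : Pro (SimplicialObject FintypeCat.{u})}
    (φ : X ⟶ Y) :
    Pro.extendMap (simplicialToCosimplicial (functionsZMod.{u} p)) (proIncl.map φ) ≫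
        (continuousCochainsIso p X).hom =
      (continuousCochainsIso p Y).hom ≫
        (simplicialToCosimplicial (Pro.extend (FintypeCat.incl.op ⋙ functionsZMod.{u} p))).map
          (proToSimplicial.map φ).op := by
  refine colimit.hom_ext fun s => ?_
  obtain ⟨t, f, hf⟩ := X.germ_surj (φ.val s.unop)
  have h1 : (proIncl.map φ).val s.unop =
      (proIncl.obj X).germ (t := t) (simplicialFiniteIncl.map f) :=
    (congrArg (Pro.mapMaps simplicialFiniteIncl X) hf.symm).trans (Pro.mapMaps_germ _ X f)
  have h2 := Pro.ι_extendMap (simplicialToCosimplicial (functionsZMod.{u} p))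
    (proIncl.map φ) s.unop
  replace h2 := (h2.trans (congrArg _ h1)).trans (Pro.pull_germ _ (proIncl.obj X) (t := t) _)
  have h3 := ι_continuousCochainsIso p Y s.unop
  have h4 := ι_continuousCochainsIso p X t
  refine (Category.assoc _ _ _).symm.trans ((congrArg (· ≫ _) h2).trans ?_)
  refine (Category.assoc _ _ _).trans ((congrArg (_ ≫ ·) h4).trans ?_)
  refine Eq.trans ?_ ((Category.assoc _ _ _).symm.trans (congrArg (· ≫ _) h3)).symm
  refine NatTrans.ext (funext fun m => ?_)
  have h5 : ((proToSimplicial.map φ).app (op m)).val s.unop =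
      ((proToSimplicial.obj X).obj (op m)).germ (t := t) (f.app (op m)) :=
    (congrArg (Pro.mapMaps ((CategoryTheory.evaluation SimplexCategoryᵒᵖ FintypeCat.{u}).obj
      (op m)) X) hf.symm).trans (Pro.mapMaps_germ _ X f)
  exact ((Pro.ι_extendMap (FintypeCat.incl.op ⋙ functionsZMod.{u} p)
    ((proToSimplicial.map φ).app (op m)) s.unop).trans ((congrArg _ h5).trans
      (Pro.pull_germ _ ((proToSimplicial.obj X).obj (op m)) (t := t) _))).symm

/-- The continuous cohomology of `F X` is the cohomology of `X`. -/
noncomputable def proFiniteCohomologyIso (n : ℕ) :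
    proIncl.op ⋙ proCohomology.{u} p n ≅ proToSimplicial.op ⋙ proFiniteCohomology p n :=
  (Functor.isoWhiskerLeft proIncl.op (proCohomologyIso p n)).symm ≪≫
    Functor.isoWhiskerRight (NatIso.ofComponents (F := proIncl.op ⋙ Pro.extend
        (simplicialToCosimplicial (functionsZMod.{u} p)))
      (G := proToSimplicial.op ⋙ simplicialToCosimplicial
        (Pro.extend (FintypeCat.incl.op ⋙ functionsZMod.{u} p)))
      (fun X => continuousCochainsIso p X.unop)
      (fun φ => continuousCochainsIso_naturality p φ.unop)) (cosimplicialCohomology p n)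

/-- The bridge between the two sides: both cohomologies are those of isomorphic cosimplicial
modules, naturally in the pro-simplicial finite set. It lets statements about F and about i be
exchanged freely. -/
lemma proToSimplicial_weakEquivalence_iff {X Y : Pro (SimplicialObject FintypeCat.{u})}
    (φ : X ⟶ Y) :
    simplicialProWeakEquivalences p (proToSimplicial.map φ) ↔
      proWeakEquivalences p (proIncl.map φ) :=
  forall_congr' fun n => (NatIso.isIso_map_iff (proFiniteCohomologyIso p n) φ.op).symm

end Comparison

/-! ### Cochains descend to simplicial finite quotients: the unit of `proFin` -/

/-- This permits elementwise arguments: elements of a filtered colimit of modules come from some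
stage, and equalities hold at some stage. -/
instance (p : ℕ) {J : Type u} [SmallCategory J] [IsFiltered J] :
    PreservesColimitsOfShape J (forget (ModuleCat.{u} (ZMod p))) :=
  inferInstanceAs (PreservesColimitsOfShape J
    (forget₂ (ModuleCat.{u} (ZMod p)) AddCommGrpCat.{u} ⋙ forget AddCommGrpCat.{u}))

/-- A criterion for a morphism of pro-objects to become an isomorphism under the extension
of a module-valued functor. -/
lemma Pro.isIso_extendMap {p : ℕ} {C : Type u₁} [Category.{u} C] (H : Cᵒᵖ ⥤ ModuleCat.{u} (ZMod p))
    {X Y : Pro C} (φ : X ⟶ Y)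
    (hinj : ∀ (s : Y.Index) (d : H.obj (op (Y.diag.obj s))), Pro.pull H X (φ.val s) d = 0 →
      colimit.ι (Y.diag.op ⋙ H) (op s) d = 0)
    (hsurj : ∀ (t : X.Index) (c : H.obj (op (X.diag.obj t))),
      ∃ (s : Y.Index) (d : H.obj (op (Y.diag.obj s))),
        Pro.pull H X (φ.val s) d = colimit.ι (X.diag.op ⋙ H) (op t) c) :
    IsIso (Pro.extendMap H φ) := by
  have key (s : Y.Index) (d : H.obj (op (Y.diag.obj s))) :
      Pro.extendMap H φ (colimit.ι (Y.diag.op ⋙ H) (op s) d) = Pro.pull H X (φ.val s) d :=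
    ConcreteCategory.congr_hom (Pro.ι_extendMap H φ s) d
  rw [ConcreteCategory.isIso_iff_bijective]
  constructor
  · refine (injective_iff_map_eq_zero (Pro.extendMap H φ).hom).2 fun x hx => ?_
    obtain ⟨s, d, rfl⟩ := Concrete.colimit_exists_rep (Y.diag.op ⋙ H) x
    exact hinj _ _ ((key _ _).symm.trans hx)
  · intro y
    obtain ⟨t, c, rfl⟩ := Concrete.colimit_exists_rep (X.diag.op ⋙ H) y
    obtain ⟨s, d, h⟩ := hsurj t.unop c
    exact ⟨_, (key s d).trans h⟩

/-- The simplicial finite quotient of `K` whose points are told apart by the values of an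
`m`-cochain. -/
def SimplicialFiniteQuotient.ofCochain {p : ℕ} [NeZero p] {K : SSet.{u}} {m : SimplexCategory}
    (c : K.obj (op m) → ZMod p) : SimplicialFiniteQuotient K where
  -- This is the kernel of the map from K to k ↦ (ℤ/p)^Hom(m, k) adjoint to c. Recording the values
  -- on all θ, not only on x itself, makes the relation simplicial.
  rel k := Setoid.ker fun (x : K.obj k) (θ : k ⟶ op m) => c (K.map θ x)
  map_rel {k l} α x y h := by
    refine funext fun θ => ?_
    have := congrFun h (α ≫ θ)
    simpa using this
  -- There are finitely many θ, because hom-sets of the simplex category are finite, and finitely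
  -- many values in ℤ/p.
  finite k := by
    have : Finite (k ⟶ op m) := Finite.of_equiv (m ⟶ k.unop) (opEquiv _ _).symm
    exact Finite.of_injective _ (Setoid.kerLift_injective _)

/-- The `m`-cochains of a pro-simplicial set and those of its simplicial finite quotients agree. -/
lemma isIso_extendMap_of_val_eq_germ_proj (p : ℕ) [NeZero p] (m : SimplexCategory)
    {X : Pro SSet.{u}} (φ : X ⟶ proIncl.obj (Pro.finObj X))
    (hφ : ∀ a : Pro.FinIndex X, φ.val a = X.germ a.quot.proj) :
    IsIso (Pro.extendMap (simplicialCochains.{u} p m) φ) := by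
  have key (a : Pro.FinIndex X) (d : (simplicialCochains.{u} p m).obj
      (op (simplicialFiniteIncl.obj a.quot.obj))) :
      Pro.pull (simplicialCochains.{u} p m) X (φ.val a) d =
        colimit.ι (X.diag.op ⋙ simplicialCochains.{u} p m) (op a.idx)
          ((simplicialCochains.{u} p m).map a.quot.proj.op d) := by
    rw [hφ]
    exact ConcreteCategory.congr_hom (Pro.pull_germ _ X _) d
  refine Pro.isIso_extendMap _ _ (fun (a : Pro.FinIndex X) d h => ?_) (fun t c => ?_)
  · obtain ⟨r, u, w, h⟩ := Concrete.colimit_exists_of_rep_eq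
      (X.diag.op ⋙ simplicialCochains.{u} p m) _ 0
      (((key a d).symm.trans h).trans (map_zero (colimit.ι (X.diag.op ⋙
        simplicialCochains.{u} p m) (op a.idx)).hom).symm)
    replace h := h.trans (map_zero ((X.diag.op ⋙ simplicialCochains.{u} p m).map w).hom)
    -- The pullback of d to X_r vanishes. The quotient in b is the image of X_r in the given
    -- quotient, so each of its simplices lifts to X_r and d restricts to zero on it.
    let b : Pro.FinIndex X := ⟨r.unop, a.quot.comap (X.diag.map u.unop)⟩
    let α : b ⟶ a := Pro.FinIndex.ofComap a u.unop _ fun _ _ _ h => h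
    have hw := ConcreteCategory.congr_hom (colimit.w
      ((proIncl.obj (Pro.finObj X)).diag.op ⋙ simplicialCochains.{u} p m) (Quiver.Hom.op α)) d
    refine hw.symm.trans ?_
    refine (congrArg (colimit.ι ((proIncl.obj (Pro.finObj X)).diag.op ⋙
      simplicialCochains.{u} p m) (op b)) ?_).trans (map_zero
        (colimit.ι ((proIncl.obj (Pro.finObj X)).diag.op ⋙
      simplicialCochains.{u} p m) (op b)).hom)
    funext x
    induction x using Quotient.inductionOn with | h x =>
    exact congrFun h x
  · let a : Pro.FinIndex X := ⟨t, SimplicialFiniteQuotient.ofCochain c⟩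
    exact ⟨a, fun x => Quotient.lift c (fun x y h => by simpa using congrFun h (𝟙 _)) x, key a _⟩

/-- The component of the unit at a pair (s, Q) is the class of the projection X_s ⟶ Q. -/
lemma proFinAdjunction_unit_weakEquivalence (p : ℕ) [NeZero p] (X : Pro SSet.{u}) :
    proWeakEquivalences p (proFinAdjunction.unit.app X) := by
  have h : proFinAdjunction.unit.app X = Pro.finHomEquiv X _ (𝟙 _) :=
    rfl
  exact proWeakEquivalences_of_cochains _ fun m =>
    isIso_extendMap_of_val_eq_germ_proj p m (proFinAdjunction.unit.app X)
      fun a => by rw [h]; exact Pro.finMaps_germ X a (𝟙 _)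

/-! ### Cofree simplicial finite sets represent cochains -/

namespace Pro

/-- An element of `colim_t Hom (X_t, A^ι)` amounts to a family of elements
of `colim_t Hom (X_t, A)`. -/
lemma maps_pi_bijective (X : Pro FintypeCat.{u}) (ι : Type) [Finite ι] (A : FintypeCat.{u}) :
    Function.Bijective fun (x : X.maps.obj (FintypeCat.of (ι → A))) (i : ι) =>
      X.maps.map (FintypeCat.homMk fun f : ι → A => f i) x := by
  let c : Fan fun _ : ι => A :=
    Fan.mk (FintypeCat.of (ι → A)) fun i => FintypeCat.homMk fun f : ι → A => f i
  have hc : IsLimit c := Fan.IsLimit.mk c (fun s => FintypeCat.homMk fun x i => s.proj i x)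
    (fun s i => rfl) (fun s f hf => by
      ext x
      funext i
      exact ConcreteCategory.congr_hom (hf i) x)
  -- A filtered colimit of representable functors preserves finite limits, in particular the finite
  -- power A^ι.
  have hc' := isLimitOfPreserves X.maps hc
  constructor
  · intro x y h
    refine (Types.isLimitEquivSections hc').injective (Subtype.ext (funext fun j => ?_))
    exact congrFun h j.as
  · intro a
    let b : (Discrete.functor (fun _ : ι => A) ⋙ X.maps).sections :=
      ⟨fun j => a j.as, by
        rintro ⟨i⟩ ⟨j⟩ f
        obtain rfl : i = j := Discrete.eq_of_hom f
        obtain rfl : f = 𝟙 _ := Subsingleton.elim _ _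
        exact Functor.map_id_apply (Discrete.functor (fun _ : ι => A) ⋙ X.maps) _ _⟩
    refine ⟨(Types.isLimitEquivSections hc').symm b, funext fun i => ?_⟩
    exact congrFun (congrArg Subtype.val ((Types.isLimitEquivSections hc').apply_symm_apply b)) ⟨i⟩

/-- The simplicial finite set `k ↦ A ^ Hom (m, k)`, cofree on the finite set `A` in degree `m`. -/
def cofree (m : SimplexCategory) (A : FintypeCat.{u}) : SimplicialObject FintypeCat.{u} where
  obj k := FintypeCat.of ((m ⟶ k.unop) → A)
  map α := FintypeCat.homMk fun f θ => f (θ ≫ α.unop)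

/-- The evaluation of the cofree simplicial finite set in degree `m`. -/
def cofreeEval (m : SimplexCategory) (A : FintypeCat.{u}) : (cofree m A).obj (op m) ⟶ A :=
  FintypeCat.homMk fun f : (m ⟶ m) → A => f (𝟙 m)

/-- The map to the cofree simplicial finite set given by a map in degree `m`. -/
def cofreeLift {m : SimplexCategory} {A : FintypeCat.{u}} {K : SimplicialObject FintypeCat.{u}}
    (f : K.obj (op m) ⟶ A) : K ⟶ cofree m A where
  app k := FintypeCat.homMk fun x (θ : m ⟶ k.unop) => f (K.map θ.op x)
  naturality k l α := by
    ext x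
    funext θ
    exact congrArg f (Functor.map_comp_apply K α θ.op x).symm

lemma cofreeLift_eval {m : SimplexCategory} {A : FintypeCat.{u}}
    {K : SimplicialObject FintypeCat.{u}} (f : K.obj (op m) ⟶ A) :
    (cofreeLift f).app (op m) ≫ cofreeEval m A = f := by
  ext x
  exact congrArg f (Functor.map_id_apply K _ x)

lemma map_cofree_eval {m : SimplexCategory} (A : FintypeCat.{u}) {k : SimplexCategoryᵒᵖ}
    (θ : m ⟶ k.unop) : (cofree m A).map (θ.op : k ⟶ op m) ≫ cofreeEval m A =
      FintypeCat.homMk fun f : (m ⟶ k.unop) → A => f θ := by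
  ext f
  exact congrArg f (Category.id_comp θ)

variable {Y : SimplicialObject (Pro FintypeCat.{u})} {m : SimplexCategory} {A : FintypeCat.{u}}

/-- Naturality of ψ along θ: each coordinate of ψ in degree k is pulled back from the identity
coordinate in degree m. Hence ψ is determined by the latter. -/
lemma app_val_cofree (ψ : Y ⟶ proToSimplicial.obj (const.obj (cofree m A)))
    {k : SimplexCategoryᵒᵖ} (θ : m ⟶ k.unop) :
    (Y.obj k).maps.map (FintypeCat.homMk fun f : (m ⟶ k.unop) → A => f θ)
        ((ψ.app k).val ⟨⟨⟩⟩) =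
      (Y.map (θ.op : k ⟶ op m)).precomp.app _
        ((Y.obj (op m)).maps.map (cofreeEval m A) ((ψ.app (op m)).val ⟨⟨⟩⟩)) := by
  let x : (Y.obj k).maps.obj ((cofree m A).obj k) := (ψ.app k).val ⟨⟨⟩⟩
  let y : (Y.obj (op m)).maps.obj ((cofree m A).obj (op m)) := (ψ.app (op m)).val ⟨⟨⟩⟩
  have h : (Y.map (θ.op : k ⟶ op m)).precomp.app _ y =
      (Y.obj k).maps.map ((cofree m A).map (θ.op : k ⟶ op m)) x :=
    app_val_naturality ψ (θ.op : k ⟶ op m) ⟨⟨⟩⟩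
  have e := congrArg (fun g => (Y.obj k).maps.map g x) (map_cofree_eval A θ)
  have e' : (Y.obj k).maps.map ((cofree m A).map (θ.op : k ⟶ op m) ≫ cofreeEval m A) x =
      (Y.obj k).maps.map (cofreeEval m A)
        ((Y.obj k).maps.map ((cofree m A).map (θ.op : k ⟶ op m)) x) :=
    Functor.map_comp_apply _ _ _ _
  have e2 := NatTrans.naturality_apply (Y.map (θ.op : k ⟶ op m)).precomp (cofreeEval m A) y
  rw [h, ← e'] at e2
  exact (e2.trans e).symm

/-- Maps `Y ⟶ F (c L)` to a cofree simplicial finite set `L` amount to maps `Y_m ⟶ A`. -/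
lemma cofree_bijective (Y : SimplicialObject (Pro FintypeCat.{u})) (m : SimplexCategory)
    (A : FintypeCat.{u}) :
    Function.Bijective fun ψ : Y ⟶ proToSimplicial.obj (const.obj (cofree m A)) =>
      (Y.obj (op m)).maps.map (cofreeEval m A) ((ψ.app (op m)).val ⟨⟨⟩⟩) := by
  constructor
  · intro ψ ψ' h
    refine NatTrans.ext (funext fun k => Pro.hom_ext fun (j : Discrete PUnit.{u + 1}) => ?_)
    refine (maps_pi_bijective (Y.obj k) (m ⟶ k.unop) A).1 (funext fun θ => ?_)
    exact (app_val_cofree ψ θ).trans ((congrArg _ h).trans (app_val_cofree ψ' θ).symm)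
  · intro a
    -- The component in degree k is forced by `app_val_cofree`: its coordinate at θ has to be the
    -- pullback of a along Y θ.
    have hb (k : SimplexCategoryᵒᵖ) := (maps_pi_bijective (Y.obj k) (m ⟶ k.unop) A).2
      fun θ => (Y.map (θ.op : k ⟶ op m)).precomp.app _ a
    choose b hb using hb
    replace hb (k : SimplexCategoryᵒᵖ) (θ : m ⟶ k.unop) :
      (Y.obj k).maps.map (FintypeCat.homMk fun f : (m ⟶ k.unop) → A => f θ) (b k) =
        (Y.map (θ.op : k ⟶ op m)).precomp.app _ a := congrFun (hb k) θ
    let ψ : Y ⟶ proToSimplicial.obj (const.obj (cofree m A)) :=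
      { app k :=
          { val _ := b k
            compat _ := Functor.map_id_apply (Y.obj k).maps _ _ }
        naturality k l α := by
          refine Pro.hom_ext fun (j : Discrete PUnit.{u + 1}) => ?_
          refine Eq.trans ?_ (Hom.precomp_germ (X := Y.obj k)
            (Y := (proToSimplicial.obj (const.obj (cofree m A))).obj k) _ (s := ⟨⟨⟩⟩)
              ((cofree m A).map α)).symm
          -- Naturality along α is checked coordinatewise: at θ both sides are the pullback of a
          -- along θ ≫ α.
          refine (maps_pi_bijective (Y.obj k) (m ⟶ l.unop) A).1 (funext fun θ => ?_)
          change (Y.obj k).maps.map (FintypeCat.homMk fun f : (m ⟶ l.unop) → A => f θ)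
              ((Y.map α).precomp.app _ (b l)) =
            (Y.obj k).maps.map (FintypeCat.homMk fun f : (m ⟶ l.unop) → A => f θ)
              ((Y.obj k).maps.map ((cofree m A).map α) (b k))
          rw [← NatTrans.naturality_apply, hb]
          refine Eq.trans ?_ (Functor.map_comp_apply (Y.obj k).maps _ _ _)
          refine Eq.trans ?_ (hb k (θ ≫ α.unop)).symm
          have : Y.map ((θ ≫ α.unop).op : k ⟶ op m) = Y.map α ≫ Y.map (θ.op : l ⟶ op m) :=
            Y.map_comp α θ.op
          rw [this, precomp_comp]
          rfl }
    refine ⟨ψ, ?_⟩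
    have h := hb (op m) (𝟙 m)
    refine h.trans ?_
    have h2 : (Y.map ((𝟙 m : m ⟶ m).op : op m ⟶ op m)) = 𝟙 _ := Y.map_id _
    rw [h2]
    obtain ⟨t, f, rfl⟩ := germ_surj _ a
    rw [Hom.precomp_germ, id_val, maps_map_germ, Category.id_comp]

end Pro

/-! ### Continuous cochains of Y and of F G Y: the unit of `simplicialToPro` -/

/-- The coefficients `ℤ/p` as a finite set. -/
abbrev zmodFintype (p : ℕ) [NeZero p] : FintypeCat.{u} := FintypeCat.of (ULift.{u} (ZMod p))

/-- Contravariant `ℤ/p`-valued functions on finite sets. -/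
abbrev finiteFunctionsZMod (p : ℕ) : FintypeCat.{u}ᵒᵖ ⥤ ModuleCat.{u} (ZMod p) :=
  FintypeCat.incl.op ⋙ functionsZMod p

namespace Pro

variable {p : ℕ} [NeZero p]

/-- The continuous function on a pro-finite set given by a map to `ℤ/p`. -/
noncomputable def toFunction (X : Pro FintypeCat.{u}) (x : X.maps.obj (zmodFintype.{u} p)) :
    (extend (finiteFunctionsZMod.{u} p)).obj (op X) :=
  pull (finiteFunctionsZMod.{u} p) X x (ULift.down : ULift.{u} (ZMod p) → ZMod p)

lemma toFunction_germ (X : Pro FintypeCat.{u}) {t : X.Index}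
    (f : X.diag.obj t ⟶ zmodFintype.{u} p) :
    X.toFunction (X.germ f) = colimit.ι (X.diag.op ⋙ finiteFunctionsZMod.{u} p) (op t)
      (fun x => (f x).down : (finiteFunctionsZMod.{u} p).obj (op (X.diag.obj t))) :=
  ConcreteCategory.congr_hom (pull_germ (finiteFunctionsZMod.{u} p) X f) _

lemma pull_eq_toFunction (X : Pro FintypeCat.{u}) {A : FintypeCat.{u}} (x : X.maps.obj A)
    (d : (finiteFunctionsZMod.{u} p).obj (op A)) :
    pull (finiteFunctionsZMod.{u} p) X x d =
      X.toFunction (X.maps.map (FintypeCat.homMk fun a => ULift.up (d a)) x) :=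
  (ConcreteCategory.congr_hom (pull_map (finiteFunctionsZMod.{u} p) X
    (FintypeCat.homMk (Y := zmodFintype.{u} p) fun a => ULift.up (d a)) x)
    (ULift.down : ULift.{u} (ZMod p) → ZMod p)).symm

/-- Two continuous functions that are equal in the colimit agree at some finite stage, and there the
maps to ℤ/p agree. This converts equalities of cochains into equalities of morphisms, to which
universal properties apply. -/
lemma toFunction_injective (X : Pro FintypeCat.{u}) :
    Function.Injective (X.toFunction (p := p)) := by
  intro x y h
  obtain ⟨s, f, rfl⟩ := X.germ_surj x
  obtain ⟨t, g, rfl⟩ := X.germ_surj y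
  rw [toFunction_germ, toFunction_germ] at h
  obtain ⟨r, a, b, h⟩ := Concrete.colimit_exists_of_rep_eq
    (X.diag.op ⋙ finiteFunctionsZMod.{u} p) _ _ h
  refine (X.germ_eq_iff _ _).2 ⟨r.unop, a.unop, b.unop, ?_⟩
  ext x
  exact congrFun h x

/-- The continuous cochains of `Y` and of `F (G Y)` agree. -/
lemma isIso_extendMap_of_val_eq (p : ℕ) [NeZero p] (Y : SimplicialObject (Pro FintypeCat.{u}))
    (m : SimplexCategory) (φ : Y ⟶ proToSimplicial.obj (ofSimplicialObj Y))
    (hφ : ∀ a : StructuredArrow Y skeletonToSimplicialPro,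
      (φ.app (op m)).val a = (a.hom.app (op m)).val ⟨⟨⟩⟩) :
    IsIso (extendMap (finiteFunctionsZMod.{u} p) (φ.app (op m))) := by
  refine isIso_extendMap _ _ (fun (a : StructuredArrow Y skeletonToSimplicialPro) d h => ?_)
    (fun t c => ?_)
  · let Z : SimplicialObject FintypeCat.{u} := skeletonIncl.obj a.right
    let x : (Y.obj (op m)).maps.obj (Z.obj (op m)) := (a.hom.app (op m)).val ⟨⟨⟩⟩
    let k (d : Z.obj (op m) → ZMod p) : Z.obj (op m) ⟶ zmodFintype.{u} p :=
      FintypeCat.homMk fun z => ULift.up (d z)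
    -- The hypothesis is that d, pulled back to Y_m along the structure map of a, is the zero
    -- function.
    have h0 : (Y.obj (op m)).maps.map (k d) x = (Y.obj (op m)).maps.map (k 0) x := by
      apply toFunction_injective (p := p)
      refine (pull_eq_toFunction _ x d).symm.trans (Eq.trans ?_ (pull_eq_toFunction _ x 0))
      refine Eq.trans ?_ (map_zero (pull (finiteFunctionsZMod.{u} p) (Y.obj (op m)) x).hom).symm
      rw [hφ] at h
      exact h
    have h1 (e : Z.obj (op m) → ZMod p) :
        (Y.obj (op m)).maps.map (cofreeEval m (zmodFintype.{u} p))
          (((a.hom ≫ proToSimplicial.map (const.map (cofreeLift (k e)))).app (op m)).val ⟨⟨⟩⟩) =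
        (Y.obj (op m)).maps.map (k e) x := by
      have h2 := app_val_comp_const (A := Z) a.hom (cofreeLift (k e)) (op m) ⟨⟨⟩⟩
      refine (congrArg _ h2).trans ?_
      refine Eq.trans (Functor.map_comp_apply (Y.obj (op m)).maps _ _ x).symm ?_
      rw [cofreeLift_eval]
    -- Cofreeness promotes the equality in degree m to one of maps out of the whole simplicial
    -- object Y.
    have h2 : a.hom ≫ proToSimplicial.map (const.map (cofreeLift (k d))) =
        a.hom ≫ proToSimplicial.map (const.map (cofreeLift (k 0))) :=
      (cofree_bijective Y m (zmodFintype.{u} p)).1 ((h1 d).trans (h0.trans (h1 0).symm))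
    -- Maps from G Y to a constant object are maps from Y, so an equality over Y already holds in
    -- the colimit over the system G Y.
    have h3 : (ofSimplicialObj Y).germ (t := a) (cofreeLift (k d)) =
        (ofSimplicialObj Y).germ (t := a) (cofreeLift (k 0)) :=
      (ofSimplicialMaps_bijective Y _).1 ((ofSimplicialMaps_germ Y a _).trans
        (h2.trans (ofSimplicialMaps_germ Y a _).symm))
    -- The function e is recovered from its cofree extension by evaluating in degree m, so the
    -- equality of extensions descends to d and 0.
    have h4 (e : Z.obj (op m) → ZMod p) :
        ((proToSimplicial.obj (ofSimplicialObj Y)).obj (op m)).germ (t := a) (k e) =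
        ((proToSimplicial.obj (ofSimplicialObj Y)).obj (op m)).maps.map
          (cofreeEval m (zmodFintype.{u} p))
          (mapMaps ((CategoryTheory.evaluation SimplexCategoryᵒᵖ FintypeCat.{u}).obj (op m))
            (ofSimplicialObj Y) ((ofSimplicialObj Y).germ (t := a) (cofreeLift (k e)))) := by
      rw [mapMaps_germ]
      refine Eq.trans ?_ (maps_map_germ
        ((proToSimplicial.obj (ofSimplicialObj Y)).obj (op m)) (t := a)
          ((cofreeLift (k e)).app (op m)) _).symm
      exact congrArg _ (cofreeLift_eval (k e)).symm
    have h5 := (h4 d).trans ((congrArg _ (congrArg _ h3)).trans (h4 0).symm)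
    have h6 := congrArg (toFunction (p := p) _) h5
    have h7 (e : Z.obj (op m) → ZMod p) := toFunction_germ (p := p)
      ((proToSimplicial.obj (ofSimplicialObj Y)).obj (op m)) (t := a) (k e)
    refine (h7 d).symm.trans ((h6.trans (h7 0)).trans ?_)
    exact (map_zero (colimit.ι (((proToSimplicial.obj
      (ofSimplicialObj Y)).obj (op m)).diag.op ⋙ finiteFunctionsZMod.{u} p) (op a)).hom)
  · let f : (Y.obj (op m)).diag.obj t ⟶ zmodFintype.{u} p :=
      FintypeCat.homMk fun x => ULift.up (c x)
    obtain ⟨ψ, hψ⟩ := (cofree_bijective Y m (zmodFintype.{u} p)).2 ((Y.obj (op m)).germ f)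
    -- The system G Y is indexed by objects of the small skeleton, so the cofree object representing
    -- c is replaced by an isomorphic Z. Then d is the tautological cochain, transported along this
    -- isomorphism.
    obtain ⟨Z, ⟨i⟩⟩ := exists_skeleton_iso (cofree m (zmodFintype.{u} p))
    let a := StructuredArrow.mk (S := Y) (Y := Z) (T := skeletonToSimplicialPro)
        (ψ ≫ proToSimplicial.map (const.map i.hom))
    let d : (skeletonIncl.obj Z).obj (op m) → ZMod p := fun z =>
      (cofreeEval m (zmodFintype.{u} p) (i.inv.app (op m) z)).down
    refine ⟨a, d, ?_⟩
    rw [hφ]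
    let x : (Y.obj (op m)).maps.obj ((skeletonIncl.obj Z).obj (op m)) :=
      (a.hom.app (op m)).val ⟨⟨⟩⟩
    refine (pull_eq_toFunction _ x d).trans ?_
    have hx := app_val_comp_const ψ i.hom (op m) ⟨⟨⟩⟩
    have h : (Y.obj (op m)).maps.map (FintypeCat.homMk (Y := zmodFintype.{u} p)
        fun z => ULift.up (d z)) x = (Y.obj (op m)).germ f := by
      refine (congrArg _ hx).trans ?_
      refine Eq.trans (Functor.map_comp_apply (Y.obj (op m)).maps _ _
        ((ψ.app (op m)).val ⟨⟨⟩⟩)).symm (Eq.trans ?_ hψ)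
      refine congrArg (fun g => (Y.obj (op m)).maps.map g ((ψ.app (op m)).val ⟨⟨⟩⟩)) ?_
      ext z
      exact congrArg (fun y => (cofreeEval m (zmodFintype.{u} p) y).down)
        (i.hom_inv_id_app_apply (op m) z)
    rw [h, toFunction_germ]
    rfl

end Pro

/-- The component of the unit at an index Y ⟶ F (c Z) of G Y is that structure map itself, because
the identity of Z induces the identity of F (c Z). -/
lemma simplicialToProAdjunction_unit_weakEquivalence (p : ℕ) [NeZero p]
    (Y : SimplicialObject (Pro FintypeCat.{u})) :
    simplicialProWeakEquivalences p (simplicialToProAdjunction.unit.app Y) := by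
  have h : simplicialToProAdjunction.unit.app Y = Pro.ofSimplicialHomEquiv Y _ (𝟙 _) := rfl
  refine simplicialProWeakEquivalences_of_cochains _ fun m =>
    Pro.isIso_extendMap_of_val_eq p Y m.unop (simplicialToProAdjunction.unit.app Y) fun a => ?_
  rw [h]
  refine (congrArg (fun k : Y ⟶ skeletonToSimplicialPro.obj a.right =>
    (k.app m).val ⟨⟨⟩⟩) (Pro.ofSimplicialMaps_germ Y a (𝟙 _))).trans ?_
  refine congrArg (fun k : Y ⟶ skeletonToSimplicialPro.obj a.right =>
    (k.app m).val ⟨⟨⟩⟩) ?_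
  exact (congrArg (a.hom ≫ ·) ((Pro.const ⋙ proToSimplicial).map_id _)).trans (Category.comp_id _)

/-! ### Formal consequences: counits, preservation of weak equivalences, zigzags -/

instance (p : ℕ) : (proWeakEquivalences.{u} p).HasTwoOutOfThreeProperty where
  comp_mem f g hf hg n := by
    have := hf n
    have := hg n
    rw [op_comp, Functor.map_comp]
    infer_instance
  of_postcomp f g hg hfg n := by
    have := hg n
    have h := hfg n
    rw [op_comp, Functor.map_comp] at h
    exact IsIso.of_isIso_comp_left ((proCohomology p n).map g.op) _
  of_precomp f g hf hfg n := by
    have := hf n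
    have h := hfg n
    rw [op_comp, Functor.map_comp] at h
    exact IsIso.of_isIso_comp_right _ ((proCohomology p n).map f.op)

instance (p : ℕ) : (simplicialProWeakEquivalences.{u} p).HasTwoOutOfThreeProperty where
  comp_mem f g hf hg n := by
    have := hf n
    have := hg n
    rw [op_comp, Functor.map_comp]
    infer_instance
  of_postcomp f g hg hfg n := by
    have := hg n
    have h := hfg n
    rw [op_comp, Functor.map_comp] at h
    exact IsIso.of_isIso_comp_left ((proFiniteCohomology p n).map g.op) _
  of_precomp f g hf hfg n := by
    have := hf n
    have h := hfg n
    rw [op_comp, Functor.map_comp] at h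
    exact IsIso.of_isIso_comp_right _ ((proFiniteCohomology p n).map f.op)

lemma proWeakEquivalences_id (p : ℕ) (X : Pro SSet.{u}) : proWeakEquivalences p (𝟙 X) :=
  fun n => by rw [op_id, CategoryTheory.Functor.map_id]; infer_instance

lemma simplicialProWeakEquivalences_id (p : ℕ) (Y : SimplicialObject (Pro FintypeCat.{u})) :
    simplicialProWeakEquivalences p (𝟙 Y) :=
  fun n => by rw [op_id, CategoryTheory.Functor.map_id]; infer_instance

section

variable (p : ℕ) [NeZero p]

/-- By the triangle identity i(counit) is a retraction of the unit at i X, so two-out-of-three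
applies. -/
lemma proFinAdjunction_counit_weakEquivalence (X : Pro (SimplicialObject FintypeCat.{u})) :
    proWeakEquivalences p (proIncl.map (proFinAdjunction.counit.app X)) := by
  refine (proWeakEquivalences p).of_precomp _ _
    (proFinAdjunction_unit_weakEquivalence p (proIncl.obj X)) ?_
  have h := proFinAdjunction.right_triangle_components X
  exact h ▸ proWeakEquivalences_id p _

/-- The triangle identity concerns F(counit); the comparison of weak equivalences transfers the
conclusion to i. -/
lemma simplicialToProAdjunction_counit_weakEquivalence
    (X : Pro (SimplicialObject FintypeCat.{u})) :
    proWeakEquivalences p (proIncl.map (simplicialToProAdjunction.counit.app X)) := by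
  rw [← proToSimplicial_weakEquivalence_iff]
  refine (simplicialProWeakEquivalences p).of_precomp _ _
    (simplicialToProAdjunction_unit_weakEquivalence p (proToSimplicial.obj X)) ?_
  have h := simplicialToProAdjunction.right_triangle_components X
  exact h ▸ simplicialProWeakEquivalences_id p _

/-- In the naturality square of the unit at f, both vertical maps are weak equivalences, so i Fin f
is one as soon as f is; then F Fin f is one too. -/
lemma proWeakEquivalences_le_inverseImage :
    proWeakEquivalences.{u} p ≤
      (simplicialProWeakEquivalences.{u} p).inverseImage (proFin.{u} ⋙ proToSimplicial.{u}) := by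
  intro X Y f hf
  refine (proToSimplicial_weakEquivalence_iff p (proFin.map f)).2 ?_
  refine (proWeakEquivalences p).of_precomp _ _ (proFinAdjunction_unit_weakEquivalence p X) ?_
  have h := proFinAdjunction.unit.naturality f
  exact h ▸ (proWeakEquivalences p).comp_mem _ _ hf (proFinAdjunction_unit_weakEquivalence p Y)

lemma simplicialProWeakEquivalences_le_inverseImage :
    simplicialProWeakEquivalences.{u} p ≤
      (proWeakEquivalences.{u} p).inverseImage (simplicialToPro.{u} ⋙ proIncl.{u}) := by
  intro X Y f hf
  refine (proToSimplicial_weakEquivalence_iff p (simplicialToPro.map f)).1 ?_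
  refine (simplicialProWeakEquivalences p).of_precomp _ _
    (simplicialToProAdjunction_unit_weakEquivalence p X) ?_
  have h := simplicialToProAdjunction.unit.naturality f
  exact h ▸ (simplicialProWeakEquivalences p).comp_mem _ _ hf
    (simplicialToProAdjunction_unit_weakEquivalence p Y)

/-- The zigzag `i G F Fin X ⟶ i Fin X ⟵ X` in the homotopy category. -/
noncomputable def hoProUnitIso :
    (proWeakEquivalences.{u} p).Q ≅
      (proFin ⋙ proToSimplicial) ⋙ (simplicialToPro ⋙ proIncl) ⋙ (proWeakEquivalences.{u} p).Q :=
  let α := Functor.whiskerRight proFinAdjunction.unit (proWeakEquivalences.{u} p).Q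
  let β := Functor.whiskerLeft proFin (Functor.whiskerRight simplicialToProAdjunction.counit
    (proIncl ⋙ (proWeakEquivalences.{u} p).Q))
  have (X : Pro SSet.{u}) : IsIso (α.app X) :=
    (proWeakEquivalences.{u} p).Q_inverts _
    (proFinAdjunction_unit_weakEquivalence p X)
  have (X : Pro SSet.{u}) : IsIso (β.app X) :=
    (proWeakEquivalences.{u} p).Q_inverts _
    (simplicialToProAdjunction_counit_weakEquivalence p (proFin.obj X))
  have : IsIso α := NatIso.isIso_of_isIso_app α
  have : IsIso β := NatIso.isIso_of_isIso_app β
  (Functor.leftUnitor _).symm ≪≫ asIso α ≪≫ (asIso β).symm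

/-- The zigzag `F Fin i G Y ⟶ F G Y ⟵ Y` in the homotopy category. -/
noncomputable def hoSimplicialProCounitIso :
    (simplicialToPro ⋙ proIncl) ⋙ (proFin ⋙ proToSimplicial) ⋙
        (simplicialProWeakEquivalences.{u} p).Q ≅
      (simplicialProWeakEquivalences.{u} p).Q :=
  let α := Functor.whiskerRight simplicialToProAdjunction.unit
    (simplicialProWeakEquivalences.{u} p).Q
  let β := Functor.whiskerLeft simplicialToPro (Functor.whiskerRight proFinAdjunction.counit
    (proToSimplicial ⋙ (simplicialProWeakEquivalences.{u} p).Q))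
  have (X : SimplicialObject (Pro FintypeCat.{u})) : IsIso (α.app X) :=
    (simplicialProWeakEquivalences.{u} p).Q_inverts _
    (simplicialToProAdjunction_unit_weakEquivalence p X)
  -- Here F, not i, is applied to the counit of `proFinAdjunction`, so the known statement is
  -- transferred from i to F.
  have (X : SimplicialObject (Pro FintypeCat.{u})) : IsIso (β.app X) :=
    (simplicialProWeakEquivalences.{u} p).Q_inverts _
    ((proToSimplicial_weakEquivalence_iff p _).2
      (proFinAdjunction_counit_weakEquivalence p (simplicialToPro.obj X)))
  have : IsIso α := NatIso.isIso_of_isIso_app α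
  have : IsIso β := NatIso.isIso_of_isIso_app β
  asIso β ≪≫ (asIso α).symm ≪≫ Functor.leftUnitor _

end

/-! ### Passage to localizations -/

section Localization

variable {C : Type u₁} [Category.{v} C] {D : Type u₂} [Category.{w} D]
  {W : MorphismProperty C} {W' : MorphismProperty D} {S : C ⥤ D} {T : D ⥤ C}
  (hS : W ≤ W'.inverseImage S) (hT : W' ≤ W.inverseImage T)

/-- The composite of the functors induced on localizations is induced by the composite. -/
noncomputable def hoFunctorCompIso :
    W.Q ⋙ hoFunctor S hS ⋙ hoFunctor T hT ≅ S ⋙ T ⋙ W.Q :=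
  (Functor.associator _ _ _).symm ≪≫
    Functor.isoWhiskerRight (eqToIso (Localization.Construction.fac (S ⋙ W'.Q) _)) _ ≪≫
      Functor.associator _ _ _ ≪≫
        Functor.isoWhiskerLeft S (eqToIso (Localization.Construction.fac (T ⋙ W.Q) _))

/-- Functors that are inverse to each other up to isomorphism after localization induce
an equivalence of localizations. -/
noncomputable def hoEquivalence (η : W.Q ≅ S ⋙ T ⋙ W.Q) (ε : T ⋙ S ⋙ W'.Q ≅ W'.Q) :
    W.Localization ≌ W'.Localization :=
  -- The composites on localizations are registered as lifts, so that the universal property extends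
  -- η and ε to natural isomorphisms between them and the identities.
  letI : Localization.Lifting W.Q W (S ⋙ T ⋙ W.Q) (hoFunctor S hS ⋙ hoFunctor T hT) :=
    ⟨hoFunctorCompIso hS hT⟩
  letI : Localization.Lifting W'.Q W' (T ⋙ S ⋙ W'.Q) (hoFunctor T hT ⋙ hoFunctor S hS) :=
    ⟨hoFunctorCompIso hT hS⟩
  -- No triangle identity is required of η and ε: the constructor corrects the unit and keeps the
  -- two functors as given.
  CategoryTheory.Equivalence.mk (hoFunctor S hS) (hoFunctor T hT)
    (Localization.liftNatIso W.Q W W.Q (S ⋙ T ⋙ W.Q) (𝟭 _) _ η)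
    (Localization.liftNatIso W'.Q W' (T ⋙ S ⋙ W'.Q) W'.Q _ (𝟭 _) ε)

end Localization

theorem mainTheorem3 (p : ℕ) [Fact p.Prime] :
    ∃ (h₁ : proWeakEquivalences.{u} p ≤
          (simplicialProWeakEquivalences.{u} p).inverseImage (proFin.{u} ⋙ proToSimplicial.{u}))
      (h₂ : simplicialProWeakEquivalences.{u} p ≤
          (proWeakEquivalences.{u} p).inverseImage (simplicialToPro.{u} ⋙ proIncl.{u}))
      (e : HoPro.{u} p ≌ HoSimplicialPro.{u} p),
      e.functor = hoFunctor (proFin.{u} ⋙ proToSimplicial.{u}) h₁ ∧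
        e.inverse = hoFunctor (simplicialToPro.{u} ⋙ proIncl.{u}) h₂ :=
  ⟨proWeakEquivalences_le_inverseImage p, simplicialProWeakEquivalences_le_inverseImage p,
    hoEquivalence (proWeakEquivalences_le_inverseImage p)
      (simplicialProWeakEquivalences_le_inverseImage p) (hoProUnitIso p)
      (hoSimplicialProCounitIso p), rfl, rfl⟩
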